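/- **Setting.** Let $f:\mathbb R^n\to\mathbb R$ and $c:\mathbb R^n\to\mathbb R^m$ be $\mathcal C^1$, with $f\ge f_{\rm low}$, and let $J$ be the Jacobian of $c$. Consider $\min f(x)$ s.t. $c(x)=0$, and the penalized problems $\min_x f(x)+\tau\|c(x)\|$ (Euclidean norms). Put $\varphi(s;x)=f(x)+\nabla f(x)^Ts$, $\varphi_Q(s;x,B)=\varphi(s;x)+\frac12s^TBs$, $\psi_\tau(s;x)=\tau\|c(x)+J(x)s\|$, $m_Q(s;x,B,\sigma)=\varphi_Q(s;x,B)+\psi_\tau(s;x)+\frac12\sigma\|s\|^2$. For $\sigma>0$ let $s_{\rm cp}(x;\sigma,\tau)$ be the minimizer of $\varphi(\cdot;x)+\psi_\tau(\cdot;x)+\frac12\sigma\|\cdot\|^2$, and let $\xi(x;\sigma,\tau)=f(x)+\tau\|c(x)\|-(\varphi+\psi_\tau)(s_{\rm cp};x)$. Let $\theta(x)=\|c(x)\|-\psi_1(s^*;x)$, where $s^*$ minimizes $\psi_1(s;x)+\frac12\|s\|^2$. **Algorithm.** Parameters: $\beta_1,\beta_3,\beta_4,\tau_0,\epsilon_0>0$,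 $0<\beta_2<1$, $0<\eta_1\le\eta_2<1$, $0<\gamma_3\le1<\gamma_1\le\gamma_2$, $\vartheta\in(0,1)$, and a starting point $x_0$. At outer iteration $k=0,1,\dots$, R2N is started from $x_{k,0}=x_k$ with $\sigma_{k,0}=\max(\beta_3\tau_k,\beta_4)$. With $\nu_{k,j}^{-1}=(\sigma_{k,j}+\|B_{k,j}\|)/\vartheta$, it stops at the first $j=:j_k$ such that $\nu_{k,j}^{-1/2}\xi(x_{k,j};\nu_{k,j}^{-1},\tau_k)^{1/2}\le\epsilon_k$. Before that, each R2N iteration computes some $s_{k,j}$ for which $m_Q(\cdot;x_{k,j},B_{k,j},\sigma_{k,j})$ (with $\tau=\tau_k$) is at most its value at $s_{\rm cp}(x_{k,j};\nu_{k,j}^{-1},\tau_k)$. Let $\rho$ be the ratio of the decrease of $f+\tau_k\|c\|$ from $x_{k,j}$ to $x_{k,j}+s_{k,j}$ to that of $\varphi_Q+\psi_{\tau_k}$ from $0$ to $s_{k,j}$. Then $x_{k,j+1}=x_{k,j}+s_{k,j}$ if $\rho\ge\eta_1$ and $x_{k,j+1}=x_{k,j}$ otherwise, and $\sigma_{k,j+1}=\max(\sigma',\beta_4)$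 with $\sigma'$ in $[\gamma_3\sigma_{k,j},\sigma_{k,j}]$ if $\rho\ge\eta_2$, in $[\sigma_{k,j},\gamma_1\sigma_{k,j}]$ if $\eta_1\le\rho<\eta_2$, in $[\gamma_1\sigma_{k,j},\gamma_2\sigma_{k,j}]$ if $\rho<\eta_1$. Set $x_{k+1}=x_{k,j_k}$. If $\theta(x_{k+1})^{1/2}>\epsilon_k$, choose $\tau_{k+1}\ge\tau_k+\beta_1$ and set $\epsilon_{k+1}=\epsilon_k$; otherwise $\tau_{k+1}=\tau_k$ and $\epsilon_{k+1}=\beta_2\epsilon_k$. **Stopping.** For $0<\epsilon\le\epsilon_0$ and $\delta\ge\epsilon$, the algorithm stops after $K$ outer iterations, where $K\ge1$ is the least index with $\theta(x_K)^{1/2}\le\epsilon$ and $\epsilon_{K-1}\le\delta$. (For $\delta\ge\epsilon_0$ this is the test $\theta(x_K)^{1/2}\le\epsilon$ alone.) The total number of inner iterations is $\sum_{k<K}j_k$. **Assumptions on the run.** $B_{k,j}=B_{k,j}^T$ and $\|B_{k,j}\|\le\kappa_B$ for all $k,j$. There are $\kappa_{m_1},\kappa_{m_2}>0$ such that for each $k$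 there is $0<\kappa_{m,k}\le\kappa_{m_1}\tau_k+\kappa_{m_2}$ with $|f(x_{k,j}+s_{k,j})+\tau_k\|c(x_{k,j}+s_{k,j})\|-(\varphi_Q+\psi_{\tau_k})(s_{k,j})|\le\kappa_{m,k}\|s_{k,j}\|^2$ at each inner iteration $j<j_k$ (models taken at $x_{k,j}$, $B_{k,j}$). **Constants.** $\alpha=\vartheta(1-\vartheta)$, $\alpha_1=1+|\log_{\gamma_1}\gamma_3|$, $\alpha_2=|1/\log\gamma_1|$, $\alpha_3=2\gamma_2/(1-\eta_2)$, $\alpha_4=\max(\beta_3,\alpha_3\kappa_{m_1})$, $\alpha_5=\max(\beta_4,\alpha_3\kappa_{m_2})$, $\kappa_h=\max_{k<K}\|c(x_{k,0})\|$, $\kappa_f=\max_{k<K}f(x_{k,0})-f_{\rm low}$, $\hat\tau=\max_{k<K}\tau_k$, and $\alpha_6(\tau)=\alpha_1(\kappa_h\tau+\kappa_f)\big((\alpha_4\tau+\alpha_5)(1+2\kappa_B)+2\kappa_B\big)$. For $\tau\ge0$ let $$N(\tau,\epsilon)=\max\Big(\Big\lceil\frac{\tau-\tau_0}{\beta_1}\Big\rceil,0\Big)+\Big\lceil\log_{\beta_2}\frac{\epsilon}{\epsilon_0}\Big\rceil+1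 .$$ **Termination** means: every inner loop is finite, $K$ exists, and $x_K$ is either an approximate KKT point ($\|\nabla f(x_K)-J(x_K)^Ty\|\le\epsilon_{K-1}$ for some $y$, and $\|c(x_K)\|\le\epsilon^2$) or an approximate infeasible critical point of the feasibility measure ($\|c(x_K)\|>\epsilon^2$, $\theta(x_K)^{1/2}\le\epsilon$, and $\|J(x_K)^Ty\|\le\epsilon$ for some $y$ with $\|y\|=1$). **Theorem.** (1) *Bounded penalty.* Let $\bar\tau\ge0$ be such that $\theta(x_{k+1})^{1/2}<\epsilon$ whenever $\tau_k\ge\bar\tau$. Then the algorithm terminates, with $K\le N(\bar\tau,\epsilon)$ and $$\sum_{k<K}j_k\le N(\bar\tau,\epsilon)\left(\frac{\alpha_6(\hat\tau)}{\eta_1\alpha(\beta_2\epsilon)^2}+\alpha_2\left|\log\frac{\alpha_4\tau_0+\alpha_5}{\beta_3\tau_0}\right|\right),$$ and $\hat\tau\le\max(\tau_0,\Lambda\bar\tau)$ for every $\Lambda\ge1$ such that $\tau_{k+1}\le\Lambda\tau_k$ for all $k$. For all $\Lambda\ge1$ and $\tau_{\rm low}>0$ there is $C>0$, depending only on $\Lambda$,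 $\tau_{\rm low}$, $f$, $c$, $f_{\rm low}$, $x_0$, $\kappa_B$, $\kappa_{m_1}$, $\kappa_{m_2}$ and the parameters, such that for all runs with $\tau_{k+1}\le\Lambda\tau_k$ for all $k$, all $\epsilon\in(0,\epsilon_0]$, all $\delta\ge\epsilon$ and all such $\bar\tau\ge\tau_{\rm low}$, $\sum_{k<K}j_k\le C\,(\bar\tau+|\log(\epsilon/\epsilon_0)|)\,\bar\tau^2\epsilon^{-2}$. (2) *Unbounded penalty.* Let instead $\tau_k\to\infty$ and $\|\nabla f(x_k)\|\le\kappa_g$ for all $k$, where $\kappa_g\ge0$. Then the algorithm terminates for all $\epsilon\in(0,\epsilon_0]$ and $\delta\ge\epsilon$. For all $\epsilon$ below a threshold $\epsilon_1>0$ that does not depend on the run, the bounds on $K$, $\hat\tau$ and $\sum_{k<K}j_k$ in (1) hold with $\bar\tau$ replaced by $(\kappa_g+1)\epsilon^{-2}+1$. For each $\Lambda\ge1$ there are $C,\epsilon_1>0$, independent of the run, $\epsilon$ and $\delta$, such that $\sum_{k<K}j_k\le C\epsilon^{-8}$ for all $\epsilon\le\min(\epsilon_0,\epsilon_1)$ and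 all runs with $\tau_{k+1}\le\Lambda\tau_k$ for all $k$. -/

import Mathlib

open Set Filter Topology

noncomputable section

namespace ExactPenalty

/-- The space `ℝⁿ` with its Euclidean norm. -/
abbrev E (n : ℕ) := EuclideanSpace ℝ (Fin n)

variable {n m : ℕ}

/-! ## Penalty function and models -/

/-- The `ℓ₂`-penalty objective `f(x) + τ ‖c(x)‖`. -/
def penObj (f : E n → ℝ) (c : E n → E m) (τ : ℝ) (x : E n) : ℝ :=
  f x + τ * ‖c x‖

/-- First-order model `φ(s; x) = f(x) + ∇f(x)ᵀ s`. -/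
def phi (f : E n → ℝ) (x s : E n) : ℝ :=
  f x + inner ℝ (gradient f x) s

/-- Quadratic model `φ_Q(s; x, B) = φ(s; x) + ½ sᵀ B s`. -/
def phiQ (f : E n → ℝ) (x : E n) (B : E n →L[ℝ] E n) (s : E n) : ℝ :=
  phi f x s + (1 / 2) * inner ℝ s (B s)

/-- Model `ψ_τ(s; x) = τ ‖c(x) + J(x) s‖` of the penalty term. -/
def psi (c : E n → E m) (τ : ℝ) (x s : E n) : ℝ :=
  τ * ‖c x + fderiv ℝ c x s‖

/-- Regularized quadratic model `m_Q(s; x, B, σ) = φ_Q(s; x, B) + ψ_τ(s; x) + ½ σ ‖s‖²`. -/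
def mQ (f : E n → ℝ) (c : E n → E m) (τ : ℝ) (x : E n) (B : E n →L[ℝ] E n) (σ : ℝ)
    (s : E n) : ℝ :=
  phiQ f x B s + psi c τ x s + (1 / 2) * σ * ‖s‖ ^ 2

/-- `s ∈ argmin_u φ(u; x) + ψ_τ(u; x) + ½ σ ‖u‖²`, where `σ` is the inverse step length. -/
def IsCauchyStep (f : E n → ℝ) (c : E n → E m) (σ τ : ℝ) (x s : E n) : Prop :=
  ∀ u, phi f x s + psi c τ x s + (1 / 2) * σ * ‖s‖ ^ 2
    ≤ phi f x u + psi c τ x u + (1 / 2) * σ * ‖u‖ ^ 2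

theorem exists_isCauchyStep (f : E n → ℝ) (c : E n → E m) {σ τ : ℝ} (hσ : 0 < σ)
    (hτ : 0 ≤ τ) (x : E n) : ∃ s, IsCauchyStep f c σ τ x s := by
  have hcont : Continuous fun u : E n =>
      phi f x u + psi c τ x u + (1 / 2) * σ * ‖u‖ ^ 2 := by
    unfold phi psi
    fun_prop
  refine hcont.exists_forall_le ?_
  have h1 : Tendsto (fun r : ℝ => f x + r * (-‖gradient f x‖ + (1 / 2) * σ * r)) atTop atTop := by
    refine tendsto_atTop_add_const_left _ _ (tendsto_id.atTop_mul_atTop₀ ?_)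
    exact tendsto_atTop_add_const_left _ _ (tendsto_id.const_mul_atTop (by positivity))
  refine tendsto_atTop_mono (fun u => ?_) (h1.comp (tendsto_norm_cocompact_atTop (E := E n)))
  have h2 : -(‖gradient f x‖ * ‖u‖) ≤ inner ℝ (gradient f x) u :=
    (abs_le.1 (abs_real_inner_le_norm (gradient f x) u)).1
  have h3 : 0 ≤ psi c τ x u := mul_nonneg hτ (norm_nonneg _)
  simp only [Function.comp, phi]
  nlinarith

theorem IsCauchyStep.unique {f : E n → ℝ} {c : E n → E m} {σ τ : ℝ} (hσ : 0 < σ)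
    (hτ : 0 ≤ τ) {x s t : E n} (hs : IsCauchyStep f c σ τ x s)
    (ht : IsCauchyStep f c σ τ x t) : s = t := by
  have h1 := hs ((1 / 2 : ℝ) • (s + t))
  have h2 := ht ((1 / 2 : ℝ) • (s + t))
  have hpsi : psi c τ x ((1 / 2 : ℝ) • (s + t)) ≤ (1 / 2) * psi c τ x s + (1 / 2) * psi c τ x t := by
    have e : c x + fderiv ℝ c x ((1 / 2 : ℝ) • (s + t))
        = (1 / 2 : ℝ) • (c x + fderiv ℝ c x s) + (1 / 2 : ℝ) • (c x + fderiv ℝ c x t) := by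
      rw [map_smul, map_add]
      module
    have h := norm_add_le ((1 / 2 : ℝ) • (c x + fderiv ℝ c x s))
      ((1 / 2 : ℝ) • (c x + fderiv ℝ c x t))
    rw [← e, norm_smul, norm_smul] at h
    norm_num at h
    unfold psi
    norm_num
    nlinarith
  have hphi : phi f x ((1 / 2 : ℝ) • (s + t)) = (1 / 2) * phi f x s + (1 / 2) * phi f x t := by
    unfold phi
    rw [inner_smul_right, inner_add_right]
    ring
  have hpar := parallelogram_law_with_norm ℝ s t
  have hn : ‖(1 / 2 : ℝ) • (s + t)‖ = (1 / 2) * ‖s + t‖ := by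
    rw [norm_smul]
    norm_num
  rw [hn, hphi] at h1 h2
  have h0 : ‖s - t‖ * ‖s - t‖ ≤ 0 := by
    by_contra hcon
    push Not at hcon
    nlinarith [mul_pos hσ hcon]
  have h4 : ‖s - t‖ = 0 := by nlinarith [norm_nonneg (s - t)]
  exact sub_eq_zero.1 (norm_eq_zero.1 h4)

/-- The Cauchy point: the minimizer of `φ(·; x) + ψ_τ(·; x) + ½ σ ‖·‖²` (it exists and is
unique for `σ > 0` and `τ ≥ 0`, by the two preceding theorems). -/
def cauchyStep (f : E n → ℝ) (c : E n → E m) (σ τ : ℝ) (x : E n) : E n :=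
  Classical.epsilon (IsCauchyStep f c σ τ x)

theorem cauchyStep_spec (f : E n → ℝ) (c : E n → E m) {σ τ : ℝ} (hσ : 0 < σ)
    (hτ : 0 ≤ τ) (x : E n) : IsCauchyStep f c σ τ x (cauchyStep f c σ τ x) :=
  Classical.epsilon_spec (exists_isCauchyStep f c hσ hτ x)

/-- `ξ(x; σ, τ) = f(x) + τ ‖c(x)‖ - (φ + ψ_τ)(s_cp; x)`. -/
def xi (f : E n → ℝ) (c : E n → E m) (σ τ : ℝ) (x : E n) : ℝ :=
  penObj f c τ x
    - (phi f x (cauchyStep f c σ τ x) + psi c τ x (cauchyStep f c σ τ x))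

/-- The feasibility measure `θ(x) = ‖c(x)‖ - ψ_1(s*; x)`, `s* ∈ prox_{ψ_1(·; x)}(0)`,
i.e. `s*` minimizes `ψ_1(s; x) + ½ ‖s‖²`. -/
def theta (c : E n → E m) (x : E n) : ℝ :=
  ‖c x‖ - psi c 1 x (cauchyStep (fun _ => 0) c 1 1 x)

/-! ## Parameters of the algorithms -/

/-- Parameters of the exact penalty algorithm (`β₁, …, β₄, τ₀, ε₀`) and of R2N
(`η₁, η₂, γ₁, γ₂, γ₃, θ`). -/
structure Params where
  (β₁ β₂ β₃ β₄ τ₀ ε₀ : ℝ)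
  (η₁ η₂ γ₁ γ₂ γ₃ θ : ℝ)
  β₁_pos : 0 < β₁
  β₂_pos : 0 < β₂
  β₂_lt : β₂ < 1
  β₃_pos : 0 < β₃
  β₄_pos : 0 < β₄
  τ₀_pos : 0 < τ₀
  ε₀_pos : 0 < ε₀
  η₁_pos : 0 < η₁
  η₁_le : η₁ ≤ η₂
  η₂_lt : η₂ < 1
  γ₃_pos : 0 < γ₃
  γ₃_le : γ₃ ≤ 1
  γ₁_gt : 1 < γ₁
  γ₁_le : γ₁ ≤ γ₂
  θ_pos : 0 < θ
  θ_lt : θ < 1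

/-! ## The exact penalty algorithm with R2N as subsolver -/

/-- All quantities produced by a run: outer iterates `x k`, penalty parameters `τ k`, inner
tolerances `ε k`, inner iterates `X k j`, inner trial steps `s k j`, regularization parameters
`σ k j` and Hessian approximations `B k j`. -/
structure Trace (n : ℕ) where
  x : ℕ → E n
  τ : ℕ → ℝ
  ε : ℕ → ℝ
  X : ℕ → ℕ → E n
  s : ℕ → ℕ → E n
  σ : ℕ → ℕ → ℝ
  B : ℕ → ℕ → (E n →L[ℝ] E n)

namespace Trace

/-- Inverse step length `ν_{k,j}⁻¹ = (σ_{k,j} + ‖B_{k,j}‖) / θ`. -/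
def nuInv (t : Trace n) (p : Params) (k j : ℕ) : ℝ :=
  (t.σ k j + ‖t.B k j‖) / p.θ

/-- Inner stationarity measure `ν_{k,j}^{-1/2} ξ(x_{k,j}; ν_{k,j}⁻¹, τ_k)^{1/2}`. -/
def measure (t : Trace n) (f : E n → ℝ) (c : E n → E m) (p : Params) (k j : ℕ) : ℝ :=
  √(t.nuInv p k j) * √(xi f c (t.nuInv p k j) (t.τ k) (t.X k j))

/-- The `k`-th inner loop has not stopped at any of the inner iterations `0, …, j`. -/
def Active (t : Trace n) (f : E n → ℝ) (c : E n → E m) (p : Params) (k j : ℕ) : Prop :=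
  ∀ i ≤ j, t.ε k < t.measure f c p k i

/-- The `k`-th inner loop stops at inner iteration `j`: it is the first one with
measure at most `ε_k`. -/
def StopsAt (t : Trace n) (f : E n → ℝ) (c : E n → E m) (p : Params) (k j : ℕ) : Prop :=
  t.measure f c p k j ≤ t.ε k ∧ ∀ i < j, t.ε k < t.measure f c p k i

/-- `ρ_{k,j}`: ratio of the achieved decrease to the decrease of the model `φ_Q + ψ_τ`. -/
def rho (t : Trace n) (f : E n → ℝ) (c : E n → E m) (k j : ℕ) : ℝ :=
  (penObj f c (t.τ k) (t.X k j) - penObj f c (t.τ k) (t.X k j + t.s k j)) /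
    ((phiQ f (t.X k j) (t.B k j) 0 + psi c (t.τ k) (t.X k j) 0)
      - (phiQ f (t.X k j) (t.B k j) (t.s k j) + psi c (t.τ k) (t.X k j) (t.s k j)))

/-- One R2N iteration, `j → j + 1`, of the `k`-th inner loop.
* The trial step is an approximate minimizer of `m_Q` that does at least as well as the
  Cauchy point; no safeguard on its length is required.
* The step is accepted when `ρ ≥ η₁`.
* `σ` is updated within the usual intervals and kept above its minimal value `β₄`. -/
structure R2NStep (t : Trace n) (f : E n → ℝ) (c : E n → E m) (p : Params) (k j : ℕ) :
    Prop where
  model_decrease :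
    mQ f c (t.τ k) (t.X k j) (t.B k j) (t.σ k j) (t.s k j) ≤
      mQ f c (t.τ k) (t.X k j) (t.B k j) (t.σ k j)
        (cauchyStep f c (t.nuInv p k j) (t.τ k) (t.X k j))
  accept : p.η₁ ≤ t.rho f c k j → t.X k (j + 1) = t.X k j + t.s k j
  reject : t.rho f c k j < p.η₁ → t.X k (j + 1) = t.X k j
  sigma_update : ∃ σ' : ℝ, t.σ k (j + 1) = max σ' p.β₄ ∧
    (p.η₂ ≤ t.rho f c k j → σ' ∈ Icc (p.γ₃ * t.σ k j) (t.σ k j)) ∧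
    (p.η₁ ≤ t.rho f c k j → t.rho f c k j < p.η₂ → σ' ∈ Icc (t.σ k j) (p.γ₁ * t.σ k j)) ∧
    (t.rho f c k j < p.η₁ → σ' ∈ Icc (p.γ₁ * t.σ k j) (p.γ₂ * t.σ k j))

/-- `t` is a run of the exact penalty algorithm started at `x₀` in which the subproblems are
solved by R2N. R2N iterations are prescribed only as long as the inner loop has not stopped, and
`x_{k+1}` only when the `k`-th inner loop stops: finiteness of the inner loops is not assumed. -/
structure IsRun (t : Trace n) (f : E n → ℝ) (c : E n → E m) (p : Params) (x₀ : E n) :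
    Prop where
  x_zero : t.x 0 = x₀
  τ_zero : t.τ 0 = p.τ₀
  ε_zero : t.ε 0 = p.ε₀
  inner_start : ∀ k, t.X k 0 = t.x k
  sigma_start : ∀ k, t.σ k 0 = max (p.β₃ * t.τ k) p.β₄
  inner_step : ∀ k j, t.Active f c p k j → t.R2NStep f c p k j
  outer_step : ∀ k j, t.StopsAt f c p k j → t.x (k + 1) = t.X k j
  increase : ∀ k, t.ε k < √(theta c (t.x (k + 1))) →
    t.τ k + p.β₁ ≤ t.τ (k + 1) ∧ t.ε (k + 1) = t.ε k
  keep : ∀ k, √(theta c (t.x (k + 1))) ≤ t.ε k →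
    t.τ (k + 1) = t.τ k ∧ t.ε (k + 1) = p.β₂ * t.ε k

/-! ## Assumptions on a run -/

/-- The Hessian approximations are symmetric and bounded by `κB`. -/
def BoundedHessians (t : Trace n) (κB : ℝ) : Prop :=
  ∀ k j, IsSelfAdjoint (t.B k j) ∧ ‖t.B k j‖ ≤ κB

/-- Model accuracy: for every outer iteration `k` there is `0 < κ_{m,k} ≤ κ_{m1} τ_k + κ_{m2}`
such that the error of the model `φ_Q + ψ_{τ_k}` at every trial step is at most
`κ_{m,k} ‖s_{k,j}‖²`. -/
def ModelAccuracy (t : Trace n) (f : E n → ℝ) (c : E n → E m) (p : Params)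
    (κm₁ κm₂ : ℝ) : Prop :=
  ∀ k, ∃ κmk : ℝ, 0 < κmk ∧ κmk ≤ κm₁ * t.τ k + κm₂ ∧ ∀ j, t.Active f c p k j →
    |penObj f c (t.τ k) (t.X k j + t.s k j)
        - (phiQ f (t.X k j) (t.B k j) (t.s k j) + psi c (t.τ k) (t.X k j) (t.s k j))|
      ≤ κmk * ‖t.s k j‖ ^ 2

/-- The penalty parameter grows at most by the factor `Λ` at each outer iteration. -/
def GrowthLE (t : Trace n) (Λ : ℝ) : Prop :=
  ∀ k, t.τ (k + 1) ≤ Λ * t.τ k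

/-! ## Iteration counts and termination -/

/-- `j_k(ε_k)`: the number of inner iterations of the `k`-th inner loop. -/
def innerCount (t : Trace n) (f : E n → ℝ) (c : E n → E m) (p : Params) (k : ℕ) : ℕ :=
  sInf {j | t.measure f c p k j ≤ t.ε k}

/-- Total number of inner iterations during the outer iterations `0, …, K - 1`. -/
def totalInner (t : Trace n) (f : E n → ℝ) (c : E n → E m) (p : Params) (K : ℕ) : ℕ :=
  ∑ k ∈ Finset.range K, t.innerCount f c p k

/-- The algorithm stops after exactly `K` outer iterations: `K` is the least `K ≥ 1` such that
`θ(x_K)^{1/2} ≤ ε` and the tolerance `ε_{K-1}` used to compute `x_K` is at most `δ`. -/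
def IsStopIndex (t : Trace n) (c : E n → E m) (ε δ : ℝ) (K : ℕ) : Prop :=
  IsLeast {K : ℕ | 1 ≤ K ∧ √(theta c (t.x K)) ≤ ε ∧ t.ε (K - 1) ≤ δ} K

/-- `κ_h = max_{k < K} ‖c(x_{k,0})‖`. -/
def kappaH (t : Trace n) (c : E n → E m) (K : ℕ) : ℝ :=
  ⨆ k : Fin K, ‖c (t.X k 0)‖

/-- `κ_f = max_{k < K} f(x_{k,0}) - f_low`. -/
def kappaF (t : Trace n) (f : E n → ℝ) (flow : ℝ) (K : ℕ) : ℝ :=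
  (⨆ k : Fin K, f (t.X k 0)) - flow

/-- The largest penalty parameter used, `max_{k < K} τ_k`. -/
def maxPenalty (t : Trace n) (K : ℕ) : ℝ :=
  ⨆ k : Fin K, t.τ k

end Trace

/-- `x` is an approximate KKT point: `‖∇f(x) - J(x)ᵀ y‖ ≤ δ` for some `y`, and
`‖c(x)‖ ≤ ζ`. -/
def IsApproxKKT (f : E n → ℝ) (c : E n → E m) (δ ζ : ℝ) (x : E n) : Prop :=
  (∃ y : E m, ‖gradient f x - ContinuousLinearMap.adjoint (fderiv ℝ c x) y‖ ≤ δ) ∧ ‖c x‖ ≤ ζ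

/-- `x` is an approximate infeasible critical point of the feasibility measure:
`‖c(x)‖ > ζ`, although `θ(x)^{1/2} ≤ ε` and `‖J(x)ᵀ y‖ ≤ ε` for some `y` with `‖y‖ = 1`. -/
def IsApproxInfeasibleCritical (c : E n → E m) (ε ζ : ℝ) (x : E n) : Prop :=
  ζ < ‖c x‖ ∧ √(theta c x) ≤ ε ∧
    ∃ y : E m, ‖y‖ = 1 ∧ ‖ContinuousLinearMap.adjoint (fderiv ℝ c x) y‖ ≤ ε

/-! ## The constants of the bounds -/

namespace Params

def α (p : Params) : ℝ := p.θ * (1 - p.θ)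

def α₁ (p : Params) : ℝ := 1 + |Real.logb p.γ₁ p.γ₃|

def α₂ (p : Params) : ℝ := |1 / Real.log p.γ₁|

def α₃ (p : Params) : ℝ := 2 * p.γ₂ / (1 - p.η₂)

def α₄ (p : Params) (κm₁ : ℝ) : ℝ := max p.β₃ (p.α₃ * κm₁)

def α₅ (p : Params) (κm₂ : ℝ) : ℝ := max p.β₄ (p.α₃ * κm₂)

def α₆ (p : Params) (κB κm₁ κm₂ κh κf τ : ℝ) : ℝ :=
  p.α₁ * (κh * τ + κf) * ((p.α₄ κm₁ * τ + p.α₅ κm₂) * (1 + 2 * κB) + 2 * κB)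

/-- Bound `⌈(τ̄ - τ₀)/β₁⌉⁺ + ⌈log_{β₂}(ε/ε₀)⌉ + 1` on the number of outer iterations
(`⌈·⌉₊` is the ceiling, replaced by `0` when negative). -/
def outerBound (p : Params) (τbar ε : ℝ) : ℕ :=
  ⌈(τbar - p.τ₀) / p.β₁⌉₊ + ⌈Real.logb p.β₂ (ε / p.ε₀)⌉₊ + 1

/-- Bound on the number of inner iterations of one outer iteration, when `τ` bounds the penalty
parameters. -/
def innerBound (p : Params) (κB κm₁ κm₂ κh κf τ ε : ℝ) : ℝ :=
  p.α₆ κB κm₁ κm₂ κh κf τ / (p.η₁ * p.α * (p.β₂ * ε) ^ 2)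
    + p.α₂ * |Real.log ((p.α₄ κm₁ * p.τ₀ + p.α₅ κm₂) / (p.β₃ * p.τ₀))|

end Params

namespace Trace

/-- The run terminates: every inner loop is finite, and for some `K` the algorithm stops after
`K` outer iterations, at an approximate KKT point or at an approximate infeasible critical point
of the feasibility measure. -/
def TerminatesAt (t : Trace n) (f : E n → ℝ) (c : E n → E m) (p : Params) (ε δ : ℝ)
    (K : ℕ) : Prop :=
  (∀ k, ∃ j, t.StopsAt f c p k j) ∧ t.IsStopIndex c ε δ K ∧
    (IsApproxKKT f c (t.ε (K - 1)) (ε ^ 2) (t.x K) ∨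
      IsApproxInfeasibleCritical c ε (ε ^ 2) (t.x K))

/-- The explicit bounds on the `K` outer iterations, on the penalty parameters used, and on the
total number of inner iterations, in terms of a threshold `τbar`. -/
def ExplicitBounds (t : Trace n) (f : E n → ℝ) (c : E n → E m) (p : Params)
    (flow κB κm₁ κm₂ τbar ε : ℝ) (K : ℕ) : Prop :=
  K ≤ p.outerBound τbar ε ∧
  (∀ Λ : ℝ, 1 ≤ Λ → t.GrowthLE Λ → t.maxPenalty K ≤ max p.τ₀ (Λ * τbar)) ∧
  (t.totalInner f c p K : ℝ) ≤ p.outerBound τbar ε *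
    p.innerBound κB κm₁ κm₂ (t.kappaH c K) (t.kappaF f flow K) (t.maxPenalty K) ε

end Trace

end ExactPenalty

end

namespace ExactPenalty

variable {n m : ℕ}

/-! The total is a bound per inner loop times a bound on the number of outer iterations.

Inner count. While loop `k` runs, the Cauchy condition makes every accepted step lower the penalty
objective by at least `η₁ α ε_k² / (M + κB)`, where `M = α₄ τ_k + α₅` bounds `σ`: a step with `ρ <
η₂` needs a model error comparable to `σ ‖s‖²`, which the accuracy assumption excludes for large
`σ`. A rejected step multiplies `σ` by at least `γ₁`. So the normalized decrease, weighted by `α₁`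
to pay for reductions of `σ`, plus `log_{γ₁} σ`, gains at least one per iteration
(`R2NStep.progress`), while its total gain is bounded (`IsRun.inner_le`).

Outer count. Each outer iteration either adds at least `β₁` to `τ` or multiplies `ε_k` by `β₂`.
Before the stop the former happens only below `τbar`, the latter only while `ε_k > ε`
(`IsRun.exists_stop_le`). With bounded gradients an explicit threshold serves as `τbar`: the step
defining `θ`, suitably scaled, competes with the Cauchy step, and for large `τ` and `√θ > ε` it
forces the inner measure up to `√θ`, whereas `τ` is increased only if that measure is at most `ε_k <
√θ` (`sqrt_theta_le_of_large_penalty`).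

At the final point, optimality of the Cauchy step yields the multiplier, and optimality of the step
defining `θ` yields the unit vector. The constants are uniform over runs because `(f - flow) / τ +
‖c‖` never increases along the outer iterates. -/

theorem nonneg_of_forall_quadratic {a b : ℝ}
    (h : ∀ t : ℝ, 0 < t → t ≤ 1 → 0 ≤ t * a + t ^ 2 * b) : 0 ≤ a := by
  by_contra! ha
  have hd : 0 < |b| - a := by linarith [abs_nonneg b]
  -- An explicit small `t` replaces the limit `t → 0` of `a + t * b`; at this value `a + t * |b|` is
  -- still negative.
  have ht : 0 < -a / (2 * (|b| - a)) := div_pos (by linarith) (by linarith)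
  have ht1 : -a / (2 * (|b| - a)) ≤ 1 := by
    rw [div_le_one (by linarith)]; linarith [abs_nonneg b]
  have key := h _ ht ht1
  set t := -a / (2 * (|b| - a)) with htdef
  have e : t * (2 * (|b| - a)) = -a := div_mul_cancel₀ _ (by linarith)
  have h1 : 0 ≤ a + t * b := by
    by_contra! hc
    have := mul_neg_of_pos_of_neg ht hc
    linarith [this, key, (by ring : t * (a + t * b) = t * a + t ^ 2 * b)]
  have h2 : t * b ≤ t * |b| := mul_le_mul_of_nonneg_left (le_abs_self b) ht.le
  nlinarith

/-! ### Optimality of the Cauchy step and multipliers -/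

theorem phi_zero (f : E n → ℝ) (x : E n) : phi f x 0 = f x := by simp [phi]

theorem psi_zero (c : E n → E m) (τ : ℝ) (x : E n) : psi c τ x 0 = τ * ‖c x‖ := by simp [psi]

theorem phi_smul (f : E n → ℝ) (x s : E n) (a : ℝ) :
    phi f x (a • s) = f x + a * inner ℝ (gradient f x) s := by
  simp [phi, inner_smul_right]

theorem psi_smul_le (c : E n → E m) {τ a : ℝ} (hτ : 0 ≤ τ) (ha : 0 ≤ a) (ha1 : a ≤ 1)
    (x s : E n) : psi c τ x (a • s) ≤ a * psi c τ x s + (1 - a) * (τ * ‖c x‖) := by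
  have e : c x + fderiv ℝ c x (a • s) = a • (c x + fderiv ℝ c x s) + (1 - a) • c x := by
    rw [map_smul]; module
  have h := norm_add_le (a • (c x + fderiv ℝ c x s)) ((1 - a) • c x)
  rw [← e, norm_smul, norm_smul, Real.norm_of_nonneg ha,
    Real.norm_of_nonneg (by linarith : 0 ≤ 1 - a)] at h
  unfold psi
  nlinarith

/-- The first-order model decrease achieved by the Cauchy step dominates `σ ‖s‖²`. -/
theorem IsCauchyStep.norm_sq_le {f : E n → ℝ} {c : E n → E m} {σ τ : ℝ} (hτ : 0 ≤ τ)
    {x s : E n} (hs : IsCauchyStep f c σ τ x s) :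
    σ * ‖s‖ ^ 2 ≤ penObj f c τ x - (phi f x s + psi c τ x s) := by
  rw [← sub_nonneg]
  refine nonneg_of_forall_quadratic (b := (1 / 2) * σ * ‖s‖ ^ 2) fun t ht ht1 => ?_
  -- Shrinking the step and letting `t → 0` yields the full `σ ‖s‖²`; comparison with the zero step
  -- alone would give half of it.
  have h := hs ((1 - t) • s)
  have h2 := psi_smul_le c hτ (by linarith : 0 ≤ 1 - t) (by linarith) x s
  rw [phi_smul, norm_smul, Real.norm_of_nonneg (by linarith : 0 ≤ 1 - t)] at h
  unfold penObj
  simp only [phi] at h ⊢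
  nlinarith

theorem xi_ge (f : E n → ℝ) (c : E n → E m) {σ τ : ℝ} (hσ : 0 < σ) (hτ : 0 ≤ τ) (x : E n) :
    σ * ‖cauchyStep f c σ τ x‖ ^ 2 ≤ xi f c σ τ x :=
  (cauchyStep_spec f c hσ hτ x).norm_sq_le hτ

theorem xi_nonneg (f : E n → ℝ) (c : E n → E m) {σ τ : ℝ} (hσ : 0 < σ) (hτ : 0 ≤ τ) (x : E n) :
    0 ≤ xi f c σ τ x :=
  le_trans (by positivity) (xi_ge f c hσ hτ x)

theorem gradient_zero_fun (x : E n) : gradient (fun _ : E n => (0 : ℝ)) x = 0 := by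
  simp [gradient]

theorem theta_eq_xi (c : E n → E m) (x : E n) : theta c x = xi (fun _ => 0) c 1 1 x := by
  simp [theta, xi, penObj, phi, gradient_zero_fun]

theorem norm_sq_le_theta (c : E n → E m) (x : E n) :
    ‖cauchyStep (fun _ => 0) c 1 1 x‖ ^ 2 ≤ theta c x := by
  rw [theta_eq_xi]
  simpa using xi_ge (fun _ => 0) c one_pos zero_le_one x

theorem theta_nonneg (c : E n → E m) (x : E n) : 0 ≤ theta c x :=
  le_trans (by positivity) (norm_sq_le_theta c x)

/-- First-order optimality of the Cauchy step at a point where the linearized constraint does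
not vanish. -/
theorem IsCauchyStep.stationary {f : E n → ℝ} {c : E n → E m} {σ τ : ℝ} (hτ : 0 ≤ τ)
    {x s : E n} (hs : IsCauchyStep f c σ τ x s) (hw : c x + fderiv ℝ c x s ≠ 0) :
    gradient f x + ContinuousLinearMap.adjoint (fderiv ℝ c x)
      ((τ / ‖c x + fderiv ℝ c x s‖) • (c x + fderiv ℝ c x s)) + σ • s = 0 := by
  set w := c x + fderiv ℝ c x s with hwdef
  have hwpos : 0 < ‖w‖ := norm_pos_iff.2 hw
  set r := gradient f x + ContinuousLinearMap.adjoint (fderiv ℝ c x) ((τ / ‖w‖) • w) + σ • s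
    with hr
  -- Moving from `s` along `-r` changes the objective by at most `-t ‖r‖²` plus a term in `t²`, so
  -- minimality forces the residual `r` to vanish.
  have key : 0 ≤ -‖r‖ ^ 2 := by
    refine nonneg_of_forall_quadratic
      (b := τ * ‖fderiv ℝ c x r‖ ^ 2 / (2 * ‖w‖) + (1 / 2) * σ * ‖r‖ ^ 2) fun t ht _ => ?_
    have h := hs (s - t • r)
    have e1 : c x + fderiv ℝ c x (s - t • r) = w - t • fderiv ℝ c x r := by
      rw [map_sub, map_smul, hwdef]; module
    have e2 : ‖w - t • fderiv ℝ c x r‖ ^ 2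
        = ‖w‖ ^ 2 - 2 * t * inner ℝ w (fderiv ℝ c x r) + t ^ 2 * ‖fderiv ℝ c x r‖ ^ 2 := by
      rw [norm_sub_sq_real, inner_smul_right, norm_smul, Real.norm_of_nonneg ht.le]; ring
    have e3 : ‖s - t • r‖ ^ 2 = ‖s‖ ^ 2 - 2 * t * inner ℝ s r + t ^ 2 * ‖r‖ ^ 2 := by
      rw [norm_sub_sq_real, inner_smul_right, norm_smul, Real.norm_of_nonneg ht.le]; ring
    have e4 : ‖r‖ ^ 2 = inner ℝ (gradient f x) r + (τ / ‖w‖) * inner ℝ w (fderiv ℝ c x r)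
        + σ * inner ℝ s r := by
      rw [← real_inner_self_eq_norm_sq]
      nth_rw 1 [hr]
      rw [inner_add_left, inner_add_left, ContinuousLinearMap.adjoint_inner_left,
        real_inner_smul_left, real_inner_smul_left]
    -- The norm is replaced by the quadratic majorant `v ↦ (‖v‖² + ‖w‖²) / (2 ‖w‖)`, which touches
    -- it at `w`; no differentiation of the norm is needed.
    have h5 : ‖w - t • fderiv ℝ c x r‖ ≤ ‖w‖ - t * inner ℝ w (fderiv ℝ c x r) / ‖w‖
        + t ^ 2 * ‖fderiv ℝ c x r‖ ^ 2 / (2 * ‖w‖) := by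
      have : ‖w - t • fderiv ℝ c x r‖
          ≤ (‖w - t • fderiv ℝ c x r‖ ^ 2 + ‖w‖ ^ 2) / (2 * ‖w‖) := by
        rw [le_div_iff₀ (by positivity)]
        nlinarith [sq_nonneg (‖w - t • fderiv ℝ c x r‖ - ‖w‖)]
      refine this.trans (le_of_eq ?_)
      rw [e2]; field_simp; ring
    have h6 := mul_le_mul_of_nonneg_left h5 hτ
    simp only [phi, psi, e1, ← hwdef, e3, inner_sub_right, inner_smul_right] at h
    have e7 : τ * (‖w‖ - t * inner ℝ w (fderiv ℝ c x r) / ‖w‖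
        + t ^ 2 * ‖fderiv ℝ c x r‖ ^ 2 / (2 * ‖w‖))
        = τ * ‖w‖ - t * ((τ / ‖w‖) * inner ℝ w (fderiv ℝ c x r))
          + t ^ 2 * (τ * ‖fderiv ℝ c x r‖ ^ 2 / (2 * ‖w‖)) := by ring
    rw [e7] at h6
    have e8 := congrArg (t * ·) e4
    linarith
  have : ‖r‖ = 0 := by nlinarith [norm_nonneg r]
  exact norm_eq_zero.1 this

/-- Existence of a Lagrange multiplier for the Cauchy step. -/
theorem IsCauchyStep.exists_multiplier {f : E n → ℝ} {c : E n → E m} {σ τ : ℝ} (hτ : 0 ≤ τ)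
    {x s : E n} (hs : IsCauchyStep f c σ τ x s) :
    ∃ y : E m, gradient f x - ContinuousLinearMap.adjoint (fderiv ℝ c x) y = -(σ • s) := by
  by_cases hw : c x + fderiv ℝ c x s = 0
  -- Here the norm has a kink, but moves within the kernel of the Jacobian leave the penalty term
  -- unchanged. Hence `∇f + σ s` is orthogonal to that kernel, so it lies in the range of the
  -- adjoint, which is closed in finite dimension.
  · have hmem : gradient f x + σ • s ∈ (LinearMap.ker (fderiv ℝ c x).toLinearMap)ᗮ := by
      have hnn : ∀ d ∈ LinearMap.ker (fderiv ℝ c x).toLinearMap,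
          0 ≤ inner ℝ (gradient f x + σ • s) d := by
        intro d hd
        have hd : fderiv ℝ c x d = 0 := hd
        refine nonneg_of_forall_quadratic (b := (1 / 2) * σ * ‖d‖ ^ 2) fun t ht _ => ?_
        have h := hs (s + t • d)
        simp only [phi, psi, map_add, map_smul, hd, smul_zero, add_zero, inner_add_right,
          inner_smul_right, norm_add_sq_real, norm_smul, Real.norm_of_nonneg ht.le] at h
        rw [inner_add_left, real_inner_smul_left]
        linarith
      rw [Submodule.mem_orthogonal']
      intro d hd
      have h1 := hnn d hd
      have h2 := hnn (-d) (Submodule.neg_mem _ hd)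
      rw [inner_neg_right] at h2
      linarith
    have e := ContinuousLinearMap.orthogonal_ker (fderiv ℝ c x)
    have e' : (LinearMap.ker (fderiv ℝ c x).toLinearMap)ᗮ
        = LinearMap.range (ContinuousLinearMap.adjoint (fderiv ℝ c x)).toLinearMap := by
      refine e.trans ?_
      exact IsClosed.submodule_topologicalClosure_eq (Submodule.closed_of_finiteDimensional _)
    rw [e'] at hmem
    obtain ⟨y, hy⟩ := hmem
    refine ⟨y, ?_⟩
    have hy : ContinuousLinearMap.adjoint (fderiv ℝ c x) y = gradient f x + σ • s := hy
    rw [hy]; abel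
  · have h := hs.stationary hτ hw
    refine ⟨-((τ / ‖c x + fderiv ℝ c x s‖) • (c x + fderiv ℝ c x s)), ?_⟩
    rw [map_neg, sub_neg_eq_add]
    exact eq_neg_of_add_eq_zero_left h

/-- The residual left by the multiplier is `σ ‖s‖`, and `σ² ‖s‖² ≤ σ ξ`. -/
theorem exists_multiplier_of_xi_le (f : E n → ℝ) (c : E n → E m) {σ τ ε : ℝ} (hσ : 0 < σ)
    (hτ : 0 ≤ τ) (x : E n) (h : √σ * √(xi f c σ τ x) ≤ ε) :
    ∃ y : E m, ‖gradient f x - ContinuousLinearMap.adjoint (fderiv ℝ c x) y‖ ≤ ε := by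
  obtain ⟨y, hy⟩ := (cauchyStep_spec f c hσ hτ x).exists_multiplier hτ
  refine ⟨y, ?_⟩
  rw [hy, norm_neg, norm_smul, Real.norm_of_nonneg hσ.le]
  refine le_trans ?_ h
  rw [← Real.sqrt_mul hσ.le]
  apply Real.le_sqrt_of_sq_le
  have := mul_le_mul_of_nonneg_left (xi_ge f c hσ hτ x) hσ.le
  linarith

/-- If the linearization vanished at `s*`, then `θ` would equal `‖c‖ > ε²`. So stationarity applies
with `f = 0`: the normalized linearization is mapped by the adjoint to `-s*`, and `‖s*‖² ≤ θ ≤ ε²`.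
-/
theorem isApproxInfeasibleCritical_of_theta_le (c : E n → E m) {ε : ℝ} (hε : 0 ≤ ε) {x : E n}
    (hθ : √(theta c x) ≤ ε) (hc : ε ^ 2 < ‖c x‖) : IsApproxInfeasibleCritical c ε (ε ^ 2) x := by
  refine ⟨hc, hθ, ?_⟩
  have hspec := cauchyStep_spec (fun _ => 0) c one_pos zero_le_one x
  have hns := norm_sq_le_theta c x
  set s := cauchyStep (fun _ => 0) c 1 1 x with hs
  have hθ2 : theta c x ≤ ε ^ 2 := (Real.sqrt_le_left hε).1 hθ
  have hw : c x + fderiv ℝ c x s ≠ 0 := by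
    intro h0
    have : theta c x = ‖c x‖ := by simp [theta, psi, ← hs, h0]
    linarith
  have h := hspec.stationary zero_le_one hw
  rw [gradient_zero_fun, zero_add, one_smul] at h
  refine ⟨(1 / ‖c x + fderiv ℝ c x s‖) • (c x + fderiv ℝ c x s), ?_, ?_⟩
  · rw [norm_smul, norm_div, norm_one, norm_norm]
    exact one_div_mul_cancel (norm_ne_zero_iff.2 hw)
  · rw [eq_neg_of_add_eq_zero_left h, norm_neg]
    exact abs_le_of_sq_le_sq' (by linarith) hε |>.2

/-! ### Large penalty parameters and the feasibility measure -/

/-- Comparison of the Cauchy step with a multiple of the step defining `θ`. -/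
theorem xi_ge_theta (f : E n → ℝ) (c : E n → E m) {σ τ κ a : ℝ} (hσ : 0 < σ) (hτ : 0 ≤ τ)
    (x : E n) (hκ : ‖gradient f x‖ ≤ κ) (ha : 0 ≤ a) (ha1 : a ≤ 1) :
    a * (τ * theta c x - κ * √(theta c x)) - (1 / 2) * σ * a ^ 2 * theta c x
      ≤ xi f c σ τ x := by
  set u := cauchyStep (fun _ => 0) c 1 1 x with hu
  have hns : ‖u‖ ^ 2 ≤ theta c x := norm_sq_le_theta c x
  have hn : ‖u‖ ≤ √(theta c x) := Real.le_sqrt_of_sq_le hns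
  have h := cauchyStep_spec f c hσ hτ x (a • u)
  have hpsi := psi_smul_le c hτ ha ha1 x u
  have hth : psi c τ x u = τ * (‖c x‖ - theta c x) := by
    simp [theta, psi, ← hu]
  rw [hth] at hpsi
  have hin : inner ℝ (gradient f x) u ≤ κ * √(theta c x) := by
    have h1 := real_inner_le_norm (gradient f x) u
    have h2 : ‖gradient f x‖ * ‖u‖ ≤ κ * √(theta c x) :=
      mul_le_mul hκ hn (norm_nonneg _) ((norm_nonneg _).trans hκ)
    linarith
  rw [phi_smul, norm_smul, Real.norm_of_nonneg ha] at h
  have h3 := mul_le_mul_of_nonneg_left hin ha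
  have h4 : (1 / 2) * σ * (a * ‖u‖) ^ 2 ≤ (1 / 2) * σ * a ^ 2 * theta c x := by
    rw [mul_pow, ← mul_assoc]
    exact mul_le_mul_of_nonneg_left hns (by positivity)
  have h5 : 0 ≤ (1 / 2) * σ * ‖cauchyStep f c σ τ x‖ ^ 2 := by positivity
  unfold xi penObj
  nlinarith

/-- Near-stationary points for a large penalty parameter are near-critical for the feasibility
measure. -/
theorem sqrt_theta_le_of_large_penalty (f : E n → ℝ) (c : E n → E m) {σ τ κ ε e D : ℝ}
    (hσ : 0 < σ) (hD : 1 ≤ D * σ) (x : E n) (hκ : ‖gradient f x‖ ≤ κ)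
    (hε : 0 < ε) (hε1 : ε ≤ 1 / (4 + 4 * D))
    (hτ : (κ + 1) * (ε ^ 2)⁻¹ + 1 ≤ τ) (he : 0 < e)
    (hm : √σ * √(xi f c σ τ x) ≤ e) (hlt : e < √(theta c x)) : √(theta c x) ≤ ε := by
  by_contra! hgt
  have hκ0 : 0 ≤ κ := (norm_nonneg _).trans hκ
  have hD0 : 0 < D := pos_of_mul_pos_left (by linarith) hσ.le
  have hτ0 : 0 ≤ τ := le_trans (by positivity) hτ
  set r := √(theta c x) with hr
  have hrr : r ^ 2 = theta c x := Real.sq_sqrt (theta_nonneg c x)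
  have hr0 : 0 < r := he.trans hlt
  have hε4 : ε * (4 + 4 * D) ≤ 1 := by rwa [le_div_iff₀ (by positivity)] at hε1
  have hτε : κ + 1 ≤ τ * ε ^ 2 := by
    have : (κ + 1) * (ε ^ 2)⁻¹ ≤ τ := by linarith
    rwa [← div_eq_mul_inv, div_le_iff₀ (by positivity)] at this
  have hε14 : ε ≤ 1 / 4 := by nlinarith
  -- Only `τ r ≥ 4 κ` and `τ ≥ 4 + 4 D` are needed below; both follow from the `ε⁻²` threshold since
  -- `ε ≤ 1 / (4 + 4 D) ≤ 1 / 4`.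
  have hτr : 4 * κ ≤ τ * r := by
    have h1 : κ + 1 ≤ τ * ε * (1 / 4) := by
      have : τ * ε ^ 2 ≤ τ * ε * (1 / 4) := by
        rw [pow_two, ← mul_assoc]; exact mul_le_mul_of_nonneg_left hε14 (by positivity)
      linarith
    have h2 : τ * ε ≤ τ * r := mul_le_mul_of_nonneg_left hgt.le hτ0
    linarith
  have hτ16 : 4 + 4 * D ≤ τ := by
    have h1 : τ * ε ^ 2 * (4 + 4 * D) ≤ τ * ε := by
      have := mul_le_mul_of_nonneg_left hε4 (by positivity : 0 ≤ τ * ε)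
      nlinarith
    have h2 : τ * ε ≤ τ * (1 / 4) := mul_le_mul_of_nonneg_left hε14 hτ0
    have h3 : 1 * (4 + 4 * D) ≤ τ * ε ^ 2 * (4 + 4 * D) :=
      mul_le_mul_of_nonneg_right (by linarith) (by positivity)
    nlinarith
  have hxi0 := xi_nonneg f c hσ hτ0 x
  have hm2 : σ * xi f c σ τ x < r ^ 2 := by
    have : σ * xi f c σ τ x ≤ e ^ 2 := by
      rw [← Real.sqrt_mul hσ.le] at hm
      exact (Real.sqrt_le_left he.le).1 hm
    nlinarith
  -- The scaling `a = min 1 (τ / σ)` maximizes `a τ - σ a² / 2` on `[0, 1]`. For `τ ≤ σ` it gives `σ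
  -- ξ ≥ τ² r² / 4`; otherwise `ξ ≥ τ r² / 4`, and `1 ≤ D σ` turns this into a bound on `σ ξ`. Both
  -- contradict `σ ξ < r²`.
  rcases le_total τ σ with hτσ | hτσ
  · have h := xi_ge_theta f c hσ hτ0 x hκ (div_nonneg hτ0 hσ.le) (by rwa [div_le_one hσ])
    rw [← hr, ← hrr] at h
    have h' := mul_le_mul_of_nonneg_left h hσ.le
    have e1 : σ * (τ / σ * (τ * r ^ 2 - κ * r) - 1 / 2 * σ * (τ / σ) ^ 2 * r ^ 2)
        = τ * r * ((1 / 2) * (τ * r) - κ) := by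
      field_simp; ring
    rw [e1] at h'
    have h2 : τ * r * ((1 / 4) * (τ * r)) ≤ τ * r * ((1 / 2) * (τ * r) - κ) :=
      mul_le_mul_of_nonneg_left (by linarith) (by positivity)
    have h3 : (1 / 4) * τ ^ 2 * r ^ 2 < 1 * r ^ 2 := by nlinarith
    have h4 := lt_of_mul_lt_mul_right h3 (by positivity)
    nlinarith
  · have h := xi_ge_theta f c hσ hτ0 x hκ zero_le_one le_rfl
    rw [← hr, ← hrr] at h
    have h1 : r * ((1 / 4) * (τ * r)) ≤ r * ((1 / 2) * (τ * r) - κ) :=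
      mul_le_mul_of_nonneg_left (by linarith) hr0.le
    have h2 : (1 / 2) * σ * r ^ 2 ≤ (1 / 2) * τ * r ^ 2 := by gcongr
    have h3 : (1 / 4) * τ * r ^ 2 ≤ xi f c σ τ x := by nlinarith
    have h4 : xi f c σ τ x ≤ D * (σ * xi f c σ τ x) := by nlinarith
    have h5 : D * (σ * xi f c σ τ x) < D * r ^ 2 := mul_lt_mul_of_pos_left hm2 hD0
    have h6 : (1 / 4) * τ * r ^ 2 < D * r ^ 2 := by linarith
    have h7 := lt_of_mul_lt_mul_right h6 (by positivity)
    linarith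

/-! ### Signs of the constants -/

namespace Params

theorem α_pos (p : Params) : 0 < p.α := mul_pos p.θ_pos (by linarith [p.θ_lt])

theorem α₁_pos (p : Params) : 0 < p.α₁ := by unfold α₁; positivity

theorem α₂_nonneg (p : Params) : 0 ≤ p.α₂ := abs_nonneg _

theorem log_γ₁_pos (p : Params) : 0 < Real.log p.γ₁ := Real.log_pos p.γ₁_gt

theorem α₂_eq (p : Params) : p.α₂ = 1 / Real.log p.γ₁ :=
  abs_of_pos (one_div_pos.2 p.log_γ₁_pos)

theorem α₄_pos (p : Params) (κm₁ : ℝ) : 0 < p.α₄ κm₁ := lt_max_of_lt_left p.β₃_pos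

theorem α₅_pos (p : Params) (κm₂ : ℝ) : 0 < p.α₅ κm₂ := lt_max_of_lt_left p.β₄_pos

theorem α₃_pos (p : Params) : 0 < p.α₃ :=
  div_pos (by linarith [p.γ₁_gt, p.γ₁_le]) (by linarith [p.η₂_lt])

end Params

/-! ### Analysis of one inner loop -/

namespace Trace

variable {t : Trace n} {f : E n → ℝ} {c : E n → E m} {p : Params} {x₀ : E n}

theorem IsRun.τ_le_succ (h : t.IsRun f c p x₀) (k : ℕ) : t.τ k ≤ t.τ (k + 1) := by
  rcases lt_or_ge (t.ε k) (√(theta c (t.x (k + 1)))) with h1 | h1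
  · linarith [(h.increase k h1).1, p.β₁_pos]
  · exact (h.keep k h1).1.ge

theorem IsRun.τ_mono (h : t.IsRun f c p x₀) : Monotone t.τ :=
  monotone_nat_of_le_succ h.τ_le_succ

theorem IsRun.τ₀_le (h : t.IsRun f c p x₀) (k : ℕ) : p.τ₀ ≤ t.τ k :=
  h.τ_zero ▸ h.τ_mono (Nat.zero_le k)

theorem IsRun.τ_pos (h : t.IsRun f c p x₀) (k : ℕ) : 0 < t.τ k :=
  p.τ₀_pos.trans_le (h.τ₀_le k)

theorem IsRun.ε_pos (h : t.IsRun f c p x₀) (k : ℕ) : 0 < t.ε k := by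
  induction k with
  | zero => rw [h.ε_zero]; exact p.ε₀_pos
  | succ k ih =>
    rcases lt_or_ge (t.ε k) (√(theta c (t.x (k + 1)))) with h1 | h1
    · rwa [(h.increase k h1).2]
    · rw [(h.keep k h1).2]; exact mul_pos p.β₂_pos ih

theorem nuInv_pos {k j : ℕ} (hσ : 0 < t.σ k j) : 0 < t.nuInv p k j :=
  div_pos (by positivity) p.θ_pos

theorem phiQ_zero (f : E n → ℝ) (x : E n) (B : E n →L[ℝ] E n) : phiQ f x B 0 = f x := by
  simp [phiQ, phi_zero]

/-- Decrease of the model `φ_Q + ψ_τ` produced by an R2N step. -/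
theorem R2NStep.model_decrease_ge {k j : ℕ} (h : t.R2NStep f c p k j) (hσ : 0 < t.σ k j)
    (hτ : 0 ≤ t.τ k) :
    (1 - p.θ) * xi f c (t.nuInv p k j) (t.τ k) (t.X k j) + (1 / 2) * t.σ k j * ‖t.s k j‖ ^ 2
      ≤ penObj f c (t.τ k) (t.X k j)
        - (phiQ f (t.X k j) (t.B k j) (t.s k j) + psi c (t.τ k) (t.X k j) (t.s k j)) := by
  have h1 := h.model_decrease
  have hν := nuInv_pos (p := p) hσ
  have h2 := xi_ge f c hν hτ (t.X k j)
  have hxi0 := xi_nonneg f c hν hτ (t.X k j)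
  have hxi : xi f c (t.nuInv p k j) (t.τ k) (t.X k j) = penObj f c (t.τ k) (t.X k j)
    - (phi f (t.X k j) (cauchyStep f c (t.nuInv p k j) (t.τ k) (t.X k j))
      + psi c (t.τ k) (t.X k j) (cauchyStep f c (t.nuInv p k j) (t.τ k) (t.X k j))) := rfl
  set u := cauchyStep f c (t.nuInv p k j) (t.τ k) (t.X k j)
  set ξ := xi f c (t.nuInv p k j) (t.τ k) (t.X k j)
  have hB : inner ℝ u (t.B k j u) ≤ ‖t.B k j‖ * ‖u‖ ^ 2 := by
    have := (real_inner_le_norm u (t.B k j u)).trans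
      (mul_le_mul_of_nonneg_left ((t.B k j).le_opNorm u) (norm_nonneg _))
    linarith
  -- The step length is chosen for this: at the Cauchy point the curvature and regularization terms
  -- together cost at most `θ ξ / 2`, with the parameter `θ`.
  have h3 : (t.σ k j + ‖t.B k j‖) * ‖u‖ ^ 2 ≤ p.θ * ξ := by
    have := mul_le_mul_of_nonneg_left h2 p.θ_pos.le
    rwa [nuInv, ← mul_assoc, mul_div_cancel₀ _ p.θ_pos.ne'] at this
  have hθξ : 0 ≤ p.θ * ξ := mul_nonneg p.θ_pos.le hxi0
  simp only [mQ, phiQ] at h1 ⊢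
  linarith

/-- The update of `σ` preserves an upper bound `M` that leaves room for unsuccessful steps. -/
theorem R2NStep.sigma_succ_bounds {k j : ℕ} (h : t.R2NStep f c p k j) {M : ℝ}
    (hσ : p.β₄ ≤ t.σ k j) (hM : t.σ k j ≤ M) (hβ : p.β₄ ≤ M)
    (hlarge : t.rho f c k j < p.η₂ → p.γ₂ * t.σ k j ≤ M) :
    p.β₄ ≤ t.σ k (j + 1) ∧ t.σ k (j + 1) ≤ M := by
  obtain ⟨σ', e, h1, h2, h3⟩ := h.sigma_update
  have hσ0 : 0 ≤ t.σ k j := p.β₄_pos.le.trans hσ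
  refine ⟨e ▸ le_max_right _ _, e ▸ max_le ?_ hβ⟩
  rcases le_or_gt p.η₂ (t.rho f c k j) with ha | ha
  · exact (h1 ha).2.trans hM
  · rcases le_or_gt p.η₁ (t.rho f c k j) with hb | hb
    · exact ((h2 hb ha).2.trans (mul_le_mul_of_nonneg_right p.γ₁_le hσ0)).trans (hlarge ha)
    · exact (h3 hb).2.trans (hlarge ha)

/-- One R2N iteration of an inner loop that has not stopped: `σ` stays within its bounds, and a
potential combining the penalty objective and `log σ` increases by at least one. -/
theorem R2NStep.progress {k j : ℕ} (h : t.R2NStep f c p k j) {M κ κB : ℝ}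
    (hσ : p.β₄ ≤ t.σ k j) (hM : t.σ k j ≤ M) (hβ : p.β₄ ≤ M) (hτ : 0 ≤ t.τ k)
    (hε : 0 < t.ε k) (hB : ‖t.B k j‖ ≤ κB) (hκ : p.α₃ * κ ≤ M)
    (hacc : |penObj f c (t.τ k) (t.X k j + t.s k j)
        - (phiQ f (t.X k j) (t.B k j) (t.s k j) + psi c (t.τ k) (t.X k j) (t.s k j))|
      ≤ κ * ‖t.s k j‖ ^ 2)
    (hm : t.ε k < t.measure f c p k j) :
    (p.β₄ ≤ t.σ k (j + 1) ∧ t.σ k (j + 1) ≤ M) ∧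
      1 ≤ p.α₁ * ((penObj f c (t.τ k) (t.X k j) - penObj f c (t.τ k) (t.X k (j + 1))) *
          (M + κB) / (p.η₁ * p.α * t.ε k ^ 2))
        + (Real.log (t.σ k (j + 1)) - Real.log (t.σ k j)) / Real.log p.γ₁ := by
  have hσ0 : 0 < t.σ k j := p.β₄_pos.trans_le hσ
  have hν := nuInv_pos (p := p) hσ0
  have hdec := h.model_decrease_ge hσ0 hτ
  have hxi0 := xi_nonneg f c hν hτ (t.X k j)
  have hθ1 : 0 < 1 - p.θ := by linarith [p.θ_lt]
  have hη1 : 0 < 1 - p.η₂ := by linarith [p.η₂_lt]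
  have hκB : 0 ≤ κB := (norm_nonneg _).trans hB
  have hm2 : t.ε k ^ 2 < t.nuInv p k j * xi f c (t.nuInv p k j) (t.τ k) (t.X k j) := by
    rw [measure, ← Real.sqrt_mul hν.le] at hm
    exact (Real.lt_sqrt hε.le).1 hm
  have hrho : t.rho f c k j = (penObj f c (t.τ k) (t.X k j)
      - penObj f c (t.τ k) (t.X k j + t.s k j)) / (penObj f c (t.τ k) (t.X k j)
        - (phiQ f (t.X k j) (t.B k j) (t.s k j) + psi c (t.τ k) (t.X k j) (t.s k j))) := by
    rw [rho, phiQ_zero, psi_zero]; rfl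
  set ξ := xi f c (t.nuInv p k j) (t.τ k) (t.X k j)
  set Δ := penObj f c (t.τ k) (t.X k j)
    - (phiQ f (t.X k j) (t.B k j) (t.s k j) + psi c (t.τ k) (t.X k j) (t.s k j)) with hΔdef
  have hξpos : 0 < ξ := by
    by_contra! hc
    nlinarith [sq_nonneg (t.ε k), mul_nonneg hν.le (sub_nonneg.2 hc)]
  have hΔξ : (1 - p.θ) * ξ ≤ Δ := by
    have : 0 ≤ (1 / 2) * t.σ k j * ‖t.s k j‖ ^ 2 := by positivity
    linarith
  have hΔ : 0 < Δ := (mul_pos hθ1 hξpos).trans_le hΔξ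
  have hΔs : (1 / 2) * t.σ k j * ‖t.s k j‖ ^ 2 < Δ := by
    linarith [mul_pos hθ1 hξpos]
  -- When `ρ < η₂`, the model error exceeds `(1 - η₂) Δ`, while `Δ > σ ‖s‖² / 2`. Hence `σ < 2 κ /
  -- (1 - η₂)`, and one increase by `γ₂` stays below `α₃ κ ≤ M`.
  have hlarge : t.rho f c k j < p.η₂ → p.γ₂ * t.σ k j ≤ M := by
    intro hr
    rw [hrho, div_lt_iff₀ hΔ] at hr
    have h1 := (abs_le.1 hacc).2
    have h2 : (1 - p.η₂) * Δ < κ * ‖t.s k j‖ ^ 2 := by linarith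
    have h3 : (1 - p.η₂) * ((1 / 2) * t.σ k j * ‖t.s k j‖ ^ 2) ≤ (1 - p.η₂) * Δ :=
      mul_le_mul_of_nonneg_left hΔs.le hη1.le
    have h4 : (1 - p.η₂) * (1 / 2) * t.σ k j * ‖t.s k j‖ ^ 2 < κ * ‖t.s k j‖ ^ 2 := by linarith
    have h5 := lt_of_mul_lt_mul_right h4 (by positivity)
    refine le_trans ?_ hκ
    rw [Params.α₃, div_mul_eq_mul_div, le_div_iff₀ hη1]
    have hγ : 0 < p.γ₂ := by linarith [p.γ₁_gt, p.γ₁_le]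
    nlinarith [mul_lt_mul_of_pos_left h5 hγ]
  have hb := h.sigma_succ_bounds hσ hM hβ hlarge
  refine ⟨hb, ?_⟩
  obtain ⟨σ', e, h1, h2, h3⟩ := h.sigma_update
  have hσ1 : 0 < t.σ k (j + 1) := p.β₄_pos.trans_le hb.1
  have hγlog := p.log_γ₁_pos
  have hden : 0 < p.η₁ * p.α * t.ε k ^ 2 := by
    have := p.α_pos; have := p.η₁_pos; positivity
  -- An accepted step lowers `log_{γ₁} σ` by at most `|log_{γ₁} γ₃| = α₁ - 1`, so a normalized
  -- decrease of at least `1`, weighted by `α₁`, suffices. A rejected step raises `log_{γ₁} σ` by at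
  -- least `1`.
  rcases le_or_gt p.η₁ (t.rho f c k j) with hs | hs
  · rw [h.accept hs]
    have hlow : p.γ₃ * t.σ k j ≤ t.σ k (j + 1) := by
      have hl1 : p.γ₃ * t.σ k j ≤ t.σ k j := by nlinarith [p.γ₃_le]
      refine le_trans ?_ (e ▸ le_max_left _ _)
      rcases le_or_gt p.η₂ (t.rho f c k j) with ha | ha
      · exact (h1 ha).1
      · exact hl1.trans (h2 hs ha).1
    have hlog : Real.log p.γ₃ ≤ Real.log (t.σ k (j + 1)) - Real.log (t.σ k j) := by
      have := Real.log_le_log (mul_pos p.γ₃_pos hσ0) hlow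
      rw [Real.log_mul p.γ₃_pos.ne' hσ0.ne'] at this
      linarith
    have hlog' : Real.logb p.γ₁ p.γ₃
        ≤ (Real.log (t.σ k (j + 1)) - Real.log (t.σ k j)) / Real.log p.γ₁ :=
      div_le_div_of_nonneg_right hlog hγlog.le
    rw [hrho, le_div_iff₀ hΔ] at hs
    -- The decrease is at least `η₁ (1 - θ) ξ`, and `ξ > ε_k² / ν⁻¹` with `θ ν⁻¹ = σ + ‖B‖ ≤ M +
    -- κB`.
    have hD : 1 ≤ (penObj f c (t.τ k) (t.X k j)
        - penObj f c (t.τ k) (t.X k j + t.s k j)) * (M + κB) / (p.η₁ * p.α * t.ε k ^ 2) := by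
      rw [le_div_iff₀ hden, one_mul]
      have hν2 : p.θ * t.nuInv p k j ≤ M + κB := by
        rw [nuInv, mul_div_cancel₀ _ p.θ_pos.ne']; linarith
      have a1 : p.θ * t.ε k ^ 2 ≤ ξ * (M + κB) := by
        have b1 := mul_le_mul_of_nonneg_left hm2.le p.θ_pos.le
        have b2 := mul_le_mul_of_nonneg_right hν2 hξpos.le
        linarith
      have a2 : p.η₁ * ((1 - p.θ) * ξ) ≤ p.η₁ * Δ :=
        mul_le_mul_of_nonneg_left hΔξ p.η₁_pos.le
      have a3 := mul_le_mul_of_nonneg_right (a2.trans hs)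
        (by linarith : 0 ≤ M + κB)
      have a4 := mul_le_mul_of_nonneg_left a1 (mul_pos p.η₁_pos hθ1).le
      unfold Params.α
      linarith
    have hα := mul_le_mul_of_nonneg_left hD p.α₁_pos.le
    have hα1 : p.α₁ = 1 + |Real.logb p.γ₁ p.γ₃| := rfl
    linarith [neg_abs_le (Real.logb p.γ₁ p.γ₃)]
  · rw [h.reject hs, sub_self, zero_mul, zero_div, mul_zero, zero_add, le_div_iff₀ hγlog, one_mul]
    have hlow : p.γ₁ * t.σ k j ≤ t.σ k (j + 1) := (h3 hs).1.trans (e ▸ le_max_left _ _)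
    have hγ : 0 < p.γ₁ := by linarith [p.γ₁_gt]
    have := Real.log_le_log (mul_pos hγ hσ0) hlow
    rw [Real.log_mul hγ.ne' hσ0.ne'] at this
    linarith

/-- The unit gains of `R2NStep.progress` telescope. The bound `α₄ τ_k + α₅` dominates the initial
`σ` and also `α₃ κ_{m,k}`. -/
theorem IsRun.inner_invariant (hrun : t.IsRun f c p x₀) {κB κm₁ κm₂ : ℝ}
    (hB : t.BoundedHessians κB) (hacc : t.ModelAccuracy f c p κm₁ κm₂)
    (k J : ℕ) (hJ : ∀ i < J, t.ε k < t.measure f c p k i) :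
    (p.β₄ ≤ t.σ k J ∧ t.σ k J ≤ p.α₄ κm₁ * t.τ k + p.α₅ κm₂) ∧
      J ≤ p.α₁ * ((penObj f c (t.τ k) (t.x k) - penObj f c (t.τ k) (t.X k J)) *
          (p.α₄ κm₁ * t.τ k + p.α₅ κm₂ + κB) / (p.η₁ * p.α * t.ε k ^ 2))
        + (Real.log (t.σ k J) - Real.log (t.σ k 0)) / Real.log p.γ₁ := by
  have hτ := hrun.τ_pos k
  have h4 : p.β₃ * t.τ k ≤ p.α₄ κm₁ * t.τ k :=
    mul_le_mul_of_nonneg_right (le_max_left _ _) hτ.le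
  have h4' : p.α₃ * κm₁ * t.τ k ≤ p.α₄ κm₁ * t.τ k :=
    mul_le_mul_of_nonneg_right (le_max_right _ _) hτ.le
  have h5 : p.β₄ ≤ p.α₅ κm₂ := le_max_left _ _
  have h5' : p.α₃ * κm₂ ≤ p.α₅ κm₂ := le_max_right _ _
  have h40 : 0 < p.α₄ κm₁ * t.τ k := mul_pos (p.α₄_pos _) hτ
  have h50 := p.α₅_pos κm₂
  induction J with
  | zero =>
    rw [hrun.inner_start, hrun.sigma_start]
    refine ⟨⟨le_max_right _ _, max_le (by linarith) (by linarith)⟩, by simp⟩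
  | succ j ih =>
    obtain ⟨⟨ih1, ih2⟩, ih3⟩ := ih fun i hi => hJ i (by omega)
    have hact : t.Active f c p k j := fun i hi => hJ i (by omega)
    obtain ⟨κ, -, hκ, ha⟩ := hacc k
    have hκM : p.α₃ * κ ≤ p.α₄ κm₁ * t.τ k + p.α₅ κm₂ := by
      have := mul_le_mul_of_nonneg_left hκ p.α₃_pos.le
      linarith
    obtain ⟨hb, hp⟩ := (hrun.inner_step k j hact).progress ih1 ih2 (by linarith) hτ.le
      (hrun.ε_pos k) (hB k j).2 hκM (ha j hact) (hJ j (by omega))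
    refine ⟨hb, ?_⟩
    push_cast
    have := add_le_add ih3 hp
    refine this.trans (le_of_eq ?_)
    ring

/-- Bound on the number of inner iterations performed before the inner loop stops. -/
theorem IsRun.inner_le (hrun : t.IsRun f c p x₀) {κB κm₁ κm₂ flow : ℝ}
    (hflow : ∀ x, flow ≤ f x)
    (hB : t.BoundedHessians κB) (hacc : t.ModelAccuracy f c p κm₁ κm₂)
    (k J : ℕ) (hJ : ∀ i < J, t.ε k < t.measure f c p k i) :
    J ≤ p.α₁ * ((‖c (t.x k)‖ * t.τ k + (f (t.x k) - flow)) *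
          (p.α₄ κm₁ * t.τ k + p.α₅ κm₂ + κB) / (p.η₁ * p.α * t.ε k ^ 2))
        + p.α₂ * |Real.log ((p.α₄ κm₁ * p.τ₀ + p.α₅ κm₂) / (p.β₃ * p.τ₀))| := by
  obtain ⟨⟨h1, h2⟩, h3⟩ := hrun.inner_invariant hB hacc k J hJ
  have hτ := hrun.τ_pos k
  have hκB : 0 ≤ κB := (norm_nonneg _).trans (hB 0 0).2
  have hM : 0 < p.α₄ κm₁ * t.τ k + p.α₅ κm₂ :=
    add_pos (mul_pos (p.α₄_pos _) hτ) (p.α₅_pos _)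
  have hα := p.α_pos
  have hη := p.η₁_pos
  have hε := hrun.ε_pos k
  refine h3.trans (add_le_add (mul_le_mul_of_nonneg_left ?_ p.α₁_pos.le) ?_)
  · refine div_le_div_of_nonneg_right (mul_le_mul_of_nonneg_right ?_ (by linarith))
      (by positivity)
    have := hflow (t.X k J)
    have := mul_nonneg hτ.le (norm_nonneg (c (t.X k J)))
    unfold penObj
    linarith
  · rw [p.α₂_eq, div_eq_mul_one_div, mul_comm]
    refine mul_le_mul_of_nonneg_left ?_ (one_div_pos.2 p.log_γ₁_pos).le
    refine le_trans ?_ (le_abs_self _)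
    have hβτ : 0 < p.β₃ * t.τ k := mul_pos p.β₃_pos hτ
    have hσ0 : p.β₃ * t.τ k ≤ t.σ k 0 := hrun.sigma_start k ▸ le_max_left _ _
    have hl1 := Real.log_le_log (p.β₄_pos.trans_le h1) h2
    have hl2 := Real.log_le_log hβτ hσ0
    -- The quotient `(α₄ τ + α₅) / (β₃ τ)` decreases in `τ`, so its value at `τ₀` bounds all outer
    -- iterations at once.
    have hl3 : (p.α₄ κm₁ * t.τ k + p.α₅ κm₂) / (p.β₃ * t.τ k)
        ≤ (p.α₄ κm₁ * p.τ₀ + p.α₅ κm₂) / (p.β₃ * p.τ₀) := by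
      rw [div_le_div_iff₀ hβτ (mul_pos p.β₃_pos p.τ₀_pos)]
      have := mul_le_mul_of_nonneg_left (hrun.τ₀_le k)
        (mul_pos (p.α₅_pos κm₂) p.β₃_pos).le
      linarith
    have hl4 := Real.log_le_log (div_pos hM hβτ) hl3
    rw [Real.log_div hM.ne' hβτ.ne'] at hl4
    linarith

/-- Every inner loop is finite. -/
theorem IsRun.exists_stopsAt (hrun : t.IsRun f c p x₀) {κB κm₁ κm₂ flow : ℝ}
    (hflow : ∀ x, flow ≤ f x)
    (hB : t.BoundedHessians κB) (hacc : t.ModelAccuracy f c p κm₁ κm₂) (k : ℕ) :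
    ∃ j, t.StopsAt f c p k j := by
  by_cases hex : ∃ j, t.measure f c p k j ≤ t.ε k
  · classical
    exact ⟨Nat.find hex, Nat.find_spec hex, fun i hi => not_le.1 (Nat.find_min hex hi)⟩
  · push Not at hex
    obtain ⟨J, hJ⟩ := exists_nat_gt (p.α₁ * ((‖c (t.x k)‖ * t.τ k + (f (t.x k) - flow)) *
          (p.α₄ κm₁ * t.τ k + p.α₅ κm₂ + κB) / (p.η₁ * p.α * t.ε k ^ 2))
        + p.α₂ * |Real.log ((p.α₄ κm₁ * p.τ₀ + p.α₅ κm₂) / (p.β₃ * p.τ₀))|)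
    exact absurd (hrun.inner_le hflow hB hacc k J fun i _ => hex i) (not_le.2 hJ)

theorem StopsAt.innerCount_eq {k j : ℕ} (h : t.StopsAt f c p k j) :
    t.innerCount f c p k = j :=
  IsLeast.csInf_eq ⟨h.1, fun i hi => not_lt.1 fun hij => absurd (h.2 i hij) (not_lt.2 hi)⟩

/-- The penalty objective does not increase during an inner loop. -/
theorem IsRun.penObj_le (hrun : t.IsRun f c p x₀) {κB κm₁ κm₂ : ℝ}
    (hB : t.BoundedHessians κB) (hacc : t.ModelAccuracy f c p κm₁ κm₂)
    (k J : ℕ) (hJ : ∀ i < J, t.ε k < t.measure f c p k i) :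
    penObj f c (t.τ k) (t.X k J) ≤ penObj f c (t.τ k) (t.x k) := by
  induction J with
  | zero => rw [hrun.inner_start]
  | succ j ih =>
    refine le_trans ?_ (ih fun i hi => hJ i (by omega))
    have hstep := hrun.inner_step k j fun i hi => hJ i (by omega)
    have hσ := (hrun.inner_invariant hB hacc k j fun i hi => hJ i (by omega)).1.1
    have hσ0 : 0 < t.σ k j := p.β₄_pos.trans_le hσ
    rcases le_or_gt p.η₁ (t.rho f c k j) with hs | hs
    · have hdec := hstep.model_decrease_ge hσ0 (hrun.τ_pos k).le
      have hxi0 := xi_nonneg f c (nuInv_pos (p := p) hσ0) (hrun.τ_pos k).le (t.X k j)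
      have hθ1 : 0 ≤ 1 - p.θ := by linarith [p.θ_lt]
      have hΔ : 0 ≤ penObj f c (t.τ k) (t.X k j)
        - (phiQ f (t.X k j) (t.B k j) (t.s k j) + psi c (t.τ k) (t.X k j) (t.s k j)) :=
        le_trans (by positivity) hdec
      rw [hstep.accept hs]
      by_contra! hc
      -- A zero model decrease is covered as well: division by zero gives `ρ = 0 < η₁`.
      have : t.rho f c k j ≤ 0 := by
        rw [rho, phiQ_zero, psi_zero]
        exact div_nonpos_of_nonpos_of_nonneg (by linarith) hΔ
      linarith [p.η₁_pos]
    · rw [hstep.reject hs]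

end Trace

/-! ### Monotonicity and growth of the bounds -/

namespace Params

theorem α₆_mono (p : Params) {κB κm₁ κm₂ κh κf τ κh' κf' τ' : ℝ} (hκB : 0 ≤ κB)
    (hκh : 0 ≤ κh) (hκf : 0 ≤ κf) (hτ : 0 ≤ τ) (h1 : κh ≤ κh') (h2 : κf ≤ κf') (h3 : τ ≤ τ') :
    p.α₆ κB κm₁ κm₂ κh κf τ ≤ p.α₆ κB κm₁ κm₂ κh' κf' τ' := by
  have := p.α₁_pos
  have := p.α₄_pos κm₁
  have := p.α₅_pos κm₂
  have := hκh.trans h1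
  have := hκf.trans h2
  have := hτ.trans h3
  unfold α₆
  gcongr

theorem α₆_nonneg (p : Params) {κB κm₁ κm₂ κh κf τ : ℝ} (hκB : 0 ≤ κB)
    (hκh : 0 ≤ κh) (hκf : 0 ≤ κf) (hτ : 0 ≤ τ) : 0 ≤ p.α₆ κB κm₁ κm₂ κh κf τ := by
  have := p.α₁_pos
  have := p.α₄_pos κm₁
  have := p.α₅_pos κm₂
  unfold α₆
  positivity

theorem innerBound_nonneg (p : Params) {κB κm₁ κm₂ κh κf τ : ℝ} (ε : ℝ) (hκB : 0 ≤ κB)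
    (hκh : 0 ≤ κh) (hκf : 0 ≤ κf) (hτ : 0 ≤ τ) : 0 ≤ p.innerBound κB κm₁ κm₂ κh κf τ ε := by
  have := p.α₆_nonneg (κm₁ := κm₁) (κm₂ := κm₂) hκB hκh hκf hτ
  have := p.α_pos
  have := p.α₂_nonneg
  have := p.η₁_pos
  unfold innerBound
  positivity

/-- Each ceiling costs at most `1`; with the final `1` this makes `3 ≤ (3 / τlow) * τbar`. -/
theorem outerBound_le (p : Params) {τbar τlow ε : ℝ} (hτlow : 0 < τlow) (hτ : τlow ≤ τbar) :
    (p.outerBound τbar ε : ℝ) ≤ (1 / p.β₁ + 3 / τlow + 1 / |Real.log p.β₂|)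
      * (τbar + |Real.log (ε / p.ε₀)|) := by
  have hβ := p.β₁_pos
  have hlog : 0 < |Real.log p.β₂| :=
    abs_pos.2 (Real.log_neg p.β₂_pos p.β₂_lt).ne
  have hτ0 : 0 < τbar := hτlow.trans_le hτ
  have h1 : (⌈(τbar - p.τ₀) / p.β₁⌉₊ : ℝ) ≤ 1 / p.β₁ * τbar + 1 := by
    have hm : ⌈(τbar - p.τ₀) / p.β₁⌉₊ ≤ ⌈1 / p.β₁ * τbar⌉₊ := by
      apply Nat.ceil_mono
      rw [one_div_mul_eq_div]
      exact div_le_div_of_nonneg_right (by linarith [p.τ₀_pos]) hβ.le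
    exact (Nat.cast_le.2 hm).trans (Nat.ceil_lt_add_one (by positivity)).le
  have h2 : (⌈Real.logb p.β₂ (ε / p.ε₀)⌉₊ : ℝ)
      ≤ 1 / |Real.log p.β₂| * |Real.log (ε / p.ε₀)| + 1 := by
    have hm : ⌈Real.logb p.β₂ (ε / p.ε₀)⌉₊
        ≤ ⌈1 / |Real.log p.β₂| * |Real.log (ε / p.ε₀)|⌉₊ := by
      apply Nat.ceil_mono
      rw [one_div_mul_eq_div, ← abs_div]
      exact le_abs_self _
    exact (Nat.cast_le.2 hm).trans (Nat.ceil_lt_add_one (by positivity)).le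
  have h3 : 3 ≤ 3 / τlow * τbar := by
    rw [div_mul_eq_mul_div, le_div_iff₀ hτlow]; linarith
  have h4 : 0 ≤ 1 / p.β₁ * |Real.log (ε / p.ε₀)| := by positivity
  have h5 : 0 ≤ 3 / τlow * |Real.log (ε / p.ε₀)| := by positivity
  have h6 : 0 ≤ 1 / |Real.log p.β₂| * τbar := by positivity
  unfold outerBound
  push_cast
  linarith

end Params

/-! ### Outer iterations and explicit bounds -/

namespace Trace

variable {t : Trace n} {f : E n → ℝ} {c : E n → E m} {p : Params} {x₀ : E n}

/-- Number of outer iterations, under the hypothesis that the penalty parameter is increased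
beyond `τbar` only at nearly feasible-critical points. -/
theorem IsRun.exists_stop_le (hrun : t.IsRun f c p x₀) {ε δ τbar : ℝ} (hε : 0 < ε)
    (hδ : ε ≤ δ)
    (hH : ∀ k, τbar ≤ t.τ k → t.ε k < √(theta c (t.x (k + 1))) → √(theta c (t.x (k + 1))) ≤ ε) :
    ∃ K ≤ p.outerBound τbar ε, 1 ≤ K ∧ √(theta c (t.x K)) ≤ ε ∧ t.ε (K - 1) ≤ δ := by
  by_contra! hcon
  have hno : ∀ k < p.outerBound τbar ε, √(theta c (t.x (k + 1))) ≤ ε → δ < t.ε k := by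
    intro k hk h
    simpa using hcon (k + 1) (by omega) (by omega) h
  -- Here `i` counts the increases of `τ` and `d` the reductions of the tolerance.
  have hinv : ∀ k ≤ p.outerBound τbar ε, ∃ i d : ℕ, i + d = k ∧ p.τ₀ + i * p.β₁ ≤ t.τ k ∧
      t.ε k = p.β₂ ^ d * p.ε₀ ∧ i ≤ ⌈(τbar - p.τ₀) / p.β₁⌉₊ ∧
      d ≤ ⌈Real.logb p.β₂ (ε / p.ε₀)⌉₊ := by
    intro k
    induction k with
    | zero => exact fun _ => ⟨0, 0, rfl, by simp [hrun.τ_zero], by simp [hrun.ε_zero], by simp,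
        by simp⟩
    | succ k ih =>
      intro hk
      obtain ⟨i, d, hid, hτ, hεk, hi, hd⟩ := ih (by omega)
      rcases lt_or_ge (t.ε k) (√(theta c (t.x (k + 1)))) with h1 | h1
      · obtain ⟨h2, h3⟩ := hrun.increase k h1
        refine ⟨i + 1, d, by omega, by push_cast; linarith, h3.trans hεk, ?_, hd⟩
        apply Nat.lt_ceil.2
        rw [lt_div_iff₀ p.β₁_pos]
        -- Beyond `τbar` an increase would give `ε_k < √θ ≤ ε ≤ δ`, so the stopping test would have
        -- held.
        by_contra! hge
        have h4 := hH k (by linarith) h1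
        linarith [hno k (by omega) h4]
      · obtain ⟨h2, h3⟩ := hrun.keep k h1
        refine ⟨i, d + 1, by omega, h2 ▸ hτ, by rw [h3, hεk]; ring, hi, ?_⟩
        apply Nat.lt_ceil.2
        have hgt : ε < t.ε k := by
          by_contra! hle
          linarith [hno k (by omega) (h1.trans hle)]
        rw [Real.logb, lt_div_iff_of_neg (Real.log_neg p.β₂_pos p.β₂_lt), ← Real.log_pow]
        refine Real.log_lt_log (div_pos hε p.ε₀_pos) ?_
        rw [div_lt_iff₀ p.ε₀_pos]
        rwa [hεk] at hgt
  obtain ⟨i, d, hid, -, -, hi, hd⟩ := hinv _ le_rfl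
  -- The final `+ 1` in the bound makes `i + d` exceed the sum of the two ceilings.
  unfold Params.outerBound at hid
  omega

theorem IsRun.exists_isStopIndex (hrun : t.IsRun f c p x₀) {ε δ τbar : ℝ} (hε : 0 < ε)
    (hδ : ε ≤ δ)
    (hH : ∀ k, τbar ≤ t.τ k → t.ε k < √(theta c (t.x (k + 1))) → √(theta c (t.x (k + 1))) ≤ ε) :
    ∃ K, t.IsStopIndex c ε δ K ∧ K ≤ p.outerBound τbar ε := by
  obtain ⟨K, hK, h⟩ := hrun.exists_stop_le hε hδ hH
  classical
  have hex : ∃ K, 1 ≤ K ∧ √(theta c (t.x K)) ≤ ε ∧ t.ε (K - 1) ≤ δ := ⟨K, h⟩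
  exact ⟨Nat.find hex, ⟨Nat.find_spec hex, fun i hi => Nat.find_min' hex hi⟩,
    (Nat.find_min' hex h).trans hK⟩

/-- Before the stop, a small `θ` can fail the test only through the tolerance. -/
theorem IsStopIndex.lt_of_succ_lt {ε δ : ℝ} {K k : ℕ} (hK : t.IsStopIndex c ε δ K)
    (hk : k + 1 < K) (h : √(theta c (t.x (k + 1))) ≤ ε) : δ < t.ε k := by
  by_contra! hle
  have : K ≤ k + 1 := hK.2 ⟨by omega, h, by simpa using hle⟩
  omega

/-- Before the stop the tolerance is reduced only while it is at least `ε`, so it undershoots `ε` by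
at most one factor `β₂`. -/
theorem IsRun.ε_ge (hrun : t.IsRun f c p x₀) {ε δ : ℝ} {K : ℕ} (hε : 0 < ε)
    (hε0 : ε ≤ p.ε₀) (hδ : ε ≤ δ) (hK : t.IsStopIndex c ε δ K) {k : ℕ} (hk : k < K) :
    p.β₂ * ε ≤ t.ε k := by
  have hβ : p.β₂ * ε ≤ ε := by nlinarith [p.β₂_lt]
  induction k with
  | zero => rw [hrun.ε_zero]; linarith
  | succ k ih =>
    rcases lt_or_ge (t.ε k) (√(theta c (t.x (k + 1)))) with h1 | h1
    · rw [(hrun.increase k h1).2]; exact ih (by omega)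
    · rw [(hrun.keep k h1).2]
      refine mul_le_mul_of_nonneg_left ?_ p.β₂_pos.le
      by_contra! hlt
      linarith [hK.lt_of_succ_lt hk (h1.trans hlt.le)]

/-- Before the stop `τ` is increased only from a value below `τbar`, so it overshoots by at most one
factor `Λ`. -/
theorem IsRun.τ_le_of_growthLE (hrun : t.IsRun f c p x₀) {ε δ τbar Λ : ℝ} {K : ℕ} (hδ : ε ≤ δ)
    (hK : t.IsStopIndex c ε δ K) (hΛ : 1 ≤ Λ) (hg : t.GrowthLE Λ)
    (hH : ∀ k, τbar ≤ t.τ k → t.ε k < √(theta c (t.x (k + 1))) → √(theta c (t.x (k + 1))) ≤ ε)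
    {k : ℕ} (hk : k < K) : t.τ k ≤ max p.τ₀ (Λ * τbar) := by
  induction k with
  | zero => rw [hrun.τ_zero]; exact le_max_left _ _
  | succ k ih =>
    rcases lt_or_ge (t.ε k) (√(theta c (t.x (k + 1)))) with h1 | h1
    · have hlt : t.τ k < τbar := by
        by_contra! hge
        have h2 := hH k hge h1
        linarith [hK.lt_of_succ_lt hk h2]
      exact ((hg k).trans (mul_le_mul_of_nonneg_left hlt.le (by linarith))).trans
        (le_max_right _ _)
    · rw [(hrun.keep k h1).1]; exact ih (by omega)

theorem le_maxPenalty {K k : ℕ} (hk : k < K) : t.τ k ≤ t.maxPenalty K :=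
  le_ciSup (f := fun i : Fin K => t.τ i) (Set.finite_range _).bddAbove ⟨k, hk⟩

theorem le_kappaH {K k : ℕ} (hk : k < K) : ‖c (t.X k 0)‖ ≤ t.kappaH c K :=
  le_ciSup (f := fun i : Fin K => ‖c (t.X i 0)‖) (Set.finite_range _).bddAbove ⟨k, hk⟩

theorem le_kappaF {K k : ℕ} (flow : ℝ) (hk : k < K) : f (t.X k 0) - flow ≤ t.kappaF f flow K :=
  sub_le_sub_right
    (le_ciSup (f := fun i : Fin K => f (t.X i 0)) (Set.finite_range _).bddAbove ⟨k, hk⟩) _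

theorem IsRun.innerCount_le (hrun : t.IsRun f c p x₀) {κB κm₁ κm₂ flow : ℝ}
    (hflow : ∀ x, flow ≤ f x) (hB : t.BoundedHessians κB)
    (hacc : t.ModelAccuracy f c p κm₁ κm₂) {ε δ : ℝ} {K : ℕ} (hε : 0 < ε)
    (hε0 : ε ≤ p.ε₀) (hδ : ε ≤ δ) (hK : t.IsStopIndex c ε δ K) {k : ℕ} (hk : k < K) :
    (t.innerCount f c p k : ℝ) ≤
      p.innerBound κB κm₁ κm₂ (t.kappaH c K) (t.kappaF f flow K) (t.maxPenalty K) ε := by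
  obtain ⟨j, hj⟩ := hrun.exists_stopsAt hflow hB hacc k
  rw [hj.innerCount_eq]
  have hκB : 0 ≤ κB := (norm_nonneg _).trans (hB 0 0).2
  have hτ := hrun.τ_pos k
  have hα := p.α_pos
  have hη := p.η₁_pos
  have hβ := p.β₂_pos
  have hα1 := p.α₁_pos
  have hα4 := p.α₄_pos κm₁
  have hα5 := p.α₅_pos κm₂
  have hκf : 0 ≤ f (t.x k) - flow := sub_nonneg.2 (hflow _)
  have h1 : ‖c (t.x k)‖ ≤ t.kappaH c K := hrun.inner_start k ▸ le_kappaH hk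
  have h2 : f (t.x k) - flow ≤ t.kappaF f flow K := hrun.inner_start k ▸ le_kappaF flow hk
  refine (hrun.inner_le hflow hB hacc k j hj.2).trans (add_le_add_left ?_ _)
  rw [← mul_div_assoc]
  have h6 := p.α₆_mono (κm₁ := κm₁) (κm₂ := κm₂) hκB (norm_nonneg _) hκf hτ.le h1 h2
    (le_maxPenalty hk)
  have h7 : p.α₁ * ((‖c (t.x k)‖ * t.τ k + (f (t.x k) - flow)) *
      (p.α₄ κm₁ * t.τ k + p.α₅ κm₂ + κB))
      ≤ p.α₆ κB κm₁ κm₂ ‖c (t.x k)‖ (f (t.x k) - flow) (t.τ k) := by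
    unfold Params.α₆
    rw [← mul_assoc]
    refine mul_le_mul_of_nonneg_left ?_ (by positivity)
    have : 0 ≤ (p.α₄ κm₁ * t.τ k + p.α₅ κm₂) * (2 * κB) := by positivity
    linarith
  have h8 := hrun.ε_ge hε hε0 hδ hK hk
  have h9 : (p.β₂ * ε) ^ 2 ≤ t.ε k ^ 2 := pow_le_pow_left₀ (by positivity) h8 2
  refine div_le_div₀ ?_ (h7.trans h6) (by positivity) ?_
  · exact le_trans (by positivity) (h7.trans h6)
  · exact mul_le_mul_of_nonneg_left h9 (by positivity)

theorem IsStopIndex.pos {ε δ : ℝ} {K : ℕ} (hK : t.IsStopIndex c ε δ K) : 0 < K := hK.1.1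

theorem IsRun.explicitBounds (hrun : t.IsRun f c p x₀) {κB κm₁ κm₂ flow : ℝ}
    (hflow : ∀ x, flow ≤ f x) (hB : t.BoundedHessians κB)
    (hacc : t.ModelAccuracy f c p κm₁ κm₂) {ε δ τbar : ℝ} {K : ℕ} (hε : 0 < ε)
    (hε0 : ε ≤ p.ε₀) (hδ : ε ≤ δ)
    (hH : ∀ k, τbar ≤ t.τ k → t.ε k < √(theta c (t.x (k + 1))) → √(theta c (t.x (k + 1))) ≤ ε)
    (hK : t.IsStopIndex c ε δ K) (hKN : K ≤ p.outerBound τbar ε) :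
    t.ExplicitBounds f c p flow κB κm₁ κm₂ τbar ε K := by
  have hKpos := hK.pos
  have : Nonempty (Fin K) := ⟨⟨0, hKpos⟩⟩
  refine ⟨hKN, fun Λ hΛ hg => ciSup_le fun k => hrun.τ_le_of_growthLE hδ hK hΛ hg hH k.2, ?_⟩
  have hκB : 0 ≤ κB := (norm_nonneg _).trans (hB 0 0).2
  have hIB := p.innerBound_nonneg (κm₁ := κm₁) (κm₂ := κm₂) ε hκB
    ((norm_nonneg _).trans (le_kappaH (t := t) (c := c) hKpos))
    ((sub_nonneg.2 (hflow _)).trans (le_kappaF (t := t) (f := f) flow hKpos))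
    ((hrun.τ_pos 0).le.trans (le_maxPenalty hKpos))
  have h1 : (t.totalInner f c p K : ℝ) ≤ K *
      p.innerBound κB κm₁ κm₂ (t.kappaH c K) (t.kappaF f flow K) (t.maxPenalty K) ε := by
    unfold totalInner
    push_cast
    refine (Finset.sum_le_card_nsmul _ _ _ fun k hk =>
      hrun.innerCount_le hflow hB hacc hε hε0 hδ hK (Finset.mem_range.1 hk)).trans ?_
    simp
  exact h1.trans (mul_le_mul_of_nonneg_right (Nat.cast_le.2 hKN) hIB)

theorem IsRun.terminatesAt (hrun : t.IsRun f c p x₀) {κB κm₁ κm₂ flow : ℝ}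
    (hflow : ∀ x, flow ≤ f x) (hB : t.BoundedHessians κB)
    (hacc : t.ModelAccuracy f c p κm₁ κm₂) {ε δ : ℝ} {K : ℕ} (hε : 0 < ε)
    (hK : t.IsStopIndex c ε δ K) : t.TerminatesAt f c p ε δ K := by
  refine ⟨hrun.exists_stopsAt hflow hB hacc, hK, ?_⟩
  -- Since `K ≥ 1`, the final point is the output of inner loop `K - 1`, which explains the
  -- tolerance `ε_{K-1}` in the KKT residual.
  obtain ⟨k, rfl⟩ : ∃ k, K = k + 1 := ⟨K - 1, by have := hK.pos; omega⟩
  rcases le_or_gt ‖c (t.x (k + 1))‖ (ε ^ 2) with h | h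
  · refine Or.inl ⟨?_, h⟩
    obtain ⟨j, hj⟩ := hrun.exists_stopsAt hflow hB hacc k
    have hσ := (hrun.inner_invariant hB hacc k j hj.2).1.1
    rw [hrun.outer_step k j hj]
    exact exists_multiplier_of_xi_le f c (nuInv_pos (p.β₄_pos.trans_le hσ)) (hrun.τ_pos k).le _
      hj.1
  · exact Or.inr (isApproxInfeasibleCritical_of_theta_le c hε.le hK.1.2.1 h)

/-! ### Complexity constants independent of the run -/

/-- The scaled, shifted penalty objective at the outer iterates stays below its initial value. -/
theorem IsRun.scaled_penObj_le (hrun : t.IsRun f c p x₀) {κB κm₁ κm₂ flow : ℝ}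
    (hflow : ∀ x, flow ≤ f x) (hB : t.BoundedHessians κB)
    (hacc : t.ModelAccuracy f c p κm₁ κm₂) (k : ℕ) :
    (f (t.x k) - flow) / t.τ k + ‖c (t.x k)‖ ≤ (f x₀ - flow) / p.τ₀ + ‖c x₀‖ := by
  induction k with
  | zero => rw [hrun.x_zero, hrun.τ_zero]
  | succ k ih =>
    refine le_trans ?_ ih
    obtain ⟨j, hj⟩ := hrun.exists_stopsAt hflow hB hacc k
    have h1 := hrun.penObj_le hB hacc k j hj.2
    rw [← hrun.outer_step k j hj] at h1
    have hτ := hrun.τ_pos k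
    -- Raising `τ` shrinks the first quotient because `f - flow ≥ 0`; this is why `f` is shifted.
    have h2 : (f (t.x (k + 1)) - flow) / t.τ (k + 1) ≤ (f (t.x (k + 1)) - flow) / t.τ k :=
      div_le_div_of_nonneg_left (sub_nonneg.2 (hflow _)) hτ (hrun.τ_le_succ k)
    have h3 : (f (t.x (k + 1)) - flow) / t.τ k + ‖c (t.x (k + 1))‖
        ≤ (f (t.x k) - flow) / t.τ k + ‖c (t.x k)‖ := by
      rw [div_add' _ _ _ hτ.ne', div_add' _ _ _ hτ.ne']
      refine div_le_div_of_nonneg_right ?_ hτ.le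
      unfold penObj at h1
      linarith
    linarith

/-- Complexity bound with a constant independent of the run. -/
theorem exists_complexity_constant (f : E n → ℝ) (c : E n → E m) {flow : ℝ}
    (hflow : ∀ x, flow ≤ f x) (p : Params) (x₀ : E n) (κB κm₁ κm₂ : ℝ) {Λ τlow : ℝ}
    (hΛ : 1 ≤ Λ) (hτlow : 0 < τlow) :
    ∃ C : ℝ, 0 < C ∧ ∀ t : Trace n, t.IsRun f c p x₀ → t.BoundedHessians κB →
      t.ModelAccuracy f c p κm₁ κm₂ → t.GrowthLE Λ →
      ∀ ε δ τbar : ℝ, 0 < ε → ε ≤ p.ε₀ → ε ≤ δ → τlow ≤ τbar →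
      (∀ k, τbar ≤ t.τ k → t.ε k < √(theta c (t.x (k + 1))) →
        √(theta c (t.x (k + 1))) ≤ ε) →
      ∃ K : ℕ, t.IsStopIndex c ε δ K ∧
        (t.totalInner f c p K : ℝ) ≤
          C * ((τbar + |Real.log (ε / p.ε₀)|) * τbar ^ 2 * (ε ^ 2)⁻¹) := by
  rcases lt_or_ge κB 0 with hneg | hκB
  · exact ⟨1, one_pos, fun t _ hB => absurd ((norm_nonneg _).trans (hB 0 0).2) (not_le.2 hneg)⟩
  set Φ := (f x₀ - flow) / p.τ₀ + ‖c x₀‖ with hΦdef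
  have hΦ : 0 ≤ Φ :=
    add_nonneg (div_nonneg (sub_nonneg.2 (hflow _)) p.τ₀_pos.le) (norm_nonneg _)
  -- Chosen so that `max τ₀ (Λ τbar) ≤ Q τbar` for all `τbar ≥ τlow`.
  set Q := p.τ₀ / τlow + Λ with hQdef
  have hα := p.α_pos
  have hη := p.η₁_pos
  have hβ := p.β₂_pos
  have hα1 := p.α₁_pos
  have hα2 := p.α₂_nonneg
  have hα4 := p.α₄_pos κm₁
  have hα5 := p.α₅_pos κm₂
  have hτ0 := p.τ₀_pos
  have hε0 := p.ε₀_pos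
  have hβ1 := p.β₁_pos
  have hQ : 0 < Q := by positivity
  -- The coefficient of `τbar²` in `α₆` after inserting `κ_h ≤ Φ`, `κ_f ≤ Φ Q τbar` and a largest
  -- penalty of at most `Q τbar`; constant terms are absorbed by `1 ≤ τbar / τlow`.
  set A := p.α₁ * (2 * Φ * Q) *
    (p.α₄ κm₁ * Q * (1 + 2 * κB) + (p.α₅ κm₂ * (1 + 2 * κB) + 2 * κB) / τlow) with hA
  set L := p.α₂ * |Real.log ((p.α₄ κm₁ * p.τ₀ + p.α₅ κm₂) / (p.β₃ * p.τ₀))| with hL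
  have hA0 : 0 ≤ A := by positivity
  have hL0 : 0 ≤ L := by positivity
  set C₁ := 1 / p.β₁ + 3 / τlow + 1 / |Real.log p.β₂|
  -- The logarithmic term `L` is absorbed by `1 ≤ (ε₀² / τlow²) (τbar² / ε²)`.
  set C₂ := A / (p.η₁ * p.α * p.β₂ ^ 2) + L * (p.ε₀ ^ 2 / τlow ^ 2)
  have hC₁ : 0 < C₁ := by positivity
  have hC₂ : 0 ≤ C₂ := by positivity
  -- Only `0 ≤ C₂` is known; the `+ 1` makes the constant positive.
  refine ⟨C₁ * C₂ + 1, by positivity, ?_⟩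
  intro t hrun hB hacc hg ε δ τbar hε hεε hδ hτbar hH
  obtain ⟨K, hK, hKN⟩ := hrun.exists_isStopIndex hε hδ hH
  refine ⟨K, hK, ?_⟩
  obtain ⟨-, h2, h3⟩ := hrun.explicitBounds hflow hB hacc hε hεε hδ hH hK hKN
  have hKpos := hK.pos
  have : Nonempty (Fin K) := ⟨⟨0, hKpos⟩⟩
  have hτb : 0 < τbar := hτlow.trans_le hτbar
  have hmax0 : 0 ≤ t.maxPenalty K := (hrun.τ_pos 0).le.trans (le_maxPenalty hKpos)
  have hmax : t.maxPenalty K ≤ Q * τbar := by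
    refine (h2 Λ hΛ hg).trans (max_le ?_ ?_)
    · have : p.τ₀ ≤ p.τ₀ / τlow * τbar := by
        rw [div_mul_eq_mul_div, le_div_iff₀ hτlow]
        exact mul_le_mul_of_nonneg_left hτbar hτ0.le
      have : 0 ≤ Λ * τbar := by positivity
      rw [hQdef, add_mul]; linarith
    · have : 0 ≤ p.τ₀ / τlow * τbar := by positivity
      rw [hQdef, add_mul]; linarith
  have hκh : t.kappaH c K ≤ Φ := by
    refine ciSup_le fun k => ?_
    rw [hrun.inner_start]
    have h := hrun.scaled_penObj_le hflow hB hacc k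
    have := div_nonneg (sub_nonneg.2 (hflow (t.x k))) (hrun.τ_pos k).le
    linarith
  have hκf : t.kappaF f flow K ≤ Φ * (Q * τbar) := by
    rw [kappaF, sub_le_iff_le_add]
    refine ciSup_le fun k => ?_
    rw [hrun.inner_start, ← sub_le_iff_le_add]
    have h : (f (t.x k) - flow) / t.τ k ≤ Φ := by
      linarith [hrun.scaled_penObj_le hflow hB hacc k, norm_nonneg (c (t.x k))]
    rw [div_le_iff₀ (hrun.τ_pos k)] at h
    exact h.trans (mul_le_mul_of_nonneg_left ((le_maxPenalty k.2).trans hmax) hΦ)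
  have h6 := p.α₆_mono (κm₁ := κm₁) (κm₂ := κm₂) hκB
    ((norm_nonneg _).trans (le_kappaH (t := t) (c := c) hKpos))
    ((sub_nonneg.2 (hflow _)).trans (le_kappaF (t := t) (f := f) flow hKpos)) hmax0 hκh hκf hmax
  have h7 : p.α₆ κB κm₁ κm₂ Φ (Φ * (Q * τbar)) (Q * τbar) ≤ A * τbar ^ 2 := by
    have h8 : p.α₅ κm₂ * (1 + 2 * κB) + 2 * κB
        ≤ (p.α₅ κm₂ * (1 + 2 * κB) + 2 * κB) / τlow * τbar := by
      rw [div_mul_eq_mul_div, le_div_iff₀ hτlow]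
      exact mul_le_mul_of_nonneg_left hτbar (by positivity)
    have h9 : p.α₁ * (2 * Φ * Q) * τbar * ((p.α₄ κm₁ * (Q * τbar) + p.α₅ κm₂) * (1 + 2 * κB)
        + 2 * κB) ≤ p.α₁ * (2 * Φ * Q) * τbar * ((p.α₄ κm₁ * Q * (1 + 2 * κB)
          + (p.α₅ κm₂ * (1 + 2 * κB) + 2 * κB) / τlow) * τbar) :=
      mul_le_mul_of_nonneg_left (by linarith) (by positivity)
    refine le_trans (le_of_eq ?_) (h9.trans (le_of_eq ?_))
    · unfold Params.α₆; ring
    · rw [hA]; ring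
  have h10 : p.innerBound κB κm₁ κm₂ (t.kappaH c K) (t.kappaF f flow K) (t.maxPenalty K) ε
      ≤ C₂ * (τbar ^ 2 * (ε ^ 2)⁻¹) := by
    have e1 : A * τbar ^ 2 / (p.η₁ * p.α * (p.β₂ * ε) ^ 2)
        = A / (p.η₁ * p.α * p.β₂ ^ 2) * (τbar ^ 2 * (ε ^ 2)⁻¹) := by
      field_simp
    have e2 : 1 ≤ p.ε₀ ^ 2 / τlow ^ 2 * (τbar ^ 2 * (ε ^ 2)⁻¹) := by
      rw [← div_eq_mul_inv, div_mul_div_comm, le_div_iff₀ (by positivity), one_mul, mul_comm]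
      exact mul_le_mul (pow_le_pow_left₀ hε.le hεε 2) (pow_le_pow_left₀ hτlow.le hτbar 2)
        (by positivity) (by positivity)
    have e3 := mul_le_mul_of_nonneg_left e2 hL0
    have e4 : p.α₆ κB κm₁ κm₂ (t.kappaH c K) (t.kappaF f flow K) (t.maxPenalty K)
        / (p.η₁ * p.α * (p.β₂ * ε) ^ 2) ≤ A * τbar ^ 2 / (p.η₁ * p.α * (p.β₂ * ε) ^ 2) :=
      div_le_div_of_nonneg_right (h6.trans h7) (by positivity)
    unfold Params.innerBound
    rw [add_mul]
    linarith
  have h11 := p.outerBound_le (ε := ε) hτlow hτbar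
  have h12 : (t.totalInner f c p K : ℝ) ≤ C₁ * (τbar + |Real.log (ε / p.ε₀)|)
      * (C₂ * (τbar ^ 2 * (ε ^ 2)⁻¹)) :=
    h3.trans ((mul_le_mul_of_nonneg_left h10 (Nat.cast_nonneg _)).trans
      (mul_le_mul_of_nonneg_right h11 (by positivity)))
  have h13 : 0 ≤ (τbar + |Real.log (ε / p.ε₀)|) * τbar ^ 2 * (ε ^ 2)⁻¹ := by positivity
  linarith

/-- Bounded gradients: beyond an explicit threshold the penalty parameter is increased only at
nearly feasible-critical points. -/
theorem IsRun.sqrt_theta_le_of_gradient_le (hrun : t.IsRun f c p x₀) {κB κm₁ κm₂ flow : ℝ}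
    (hflow : ∀ x, flow ≤ f x) (hB : t.BoundedHessians κB)
    (hacc : t.ModelAccuracy f c p κm₁ κm₂) {κg ε : ℝ}
    (hg : ∀ k, ‖gradient f (t.x k)‖ ≤ κg) (hε : 0 < ε)
    (hε1 : ε ≤ 1 / (4 + 4 * (p.θ / p.β₄))) (k : ℕ)
    (hτ : (κg + 1) * (ε ^ 2)⁻¹ + 1 ≤ t.τ k) (hlt : t.ε k < √(theta c (t.x (k + 1)))) :
    √(theta c (t.x (k + 1))) ≤ ε := by
  obtain ⟨j, hj⟩ := hrun.exists_stopsAt hflow hB hacc k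
  have hσ := (hrun.inner_invariant hB hacc k j hj.2).1.1
  have hσ0 := p.β₄_pos.trans_le hσ
  refine sqrt_theta_le_of_large_penalty f c (nuInv_pos (p := p) hσ0) (D := p.θ / p.β₄) ?_ _
    (hg (k + 1)) hε hε1 hτ (hrun.ε_pos k) ?_ hlt
  -- The floor `σ ≥ β₄` gives `ν⁻¹ ≥ β₄ / θ`, hence the choice `D = θ / β₄`.
  · have := p.θ_pos
    have := p.β₄_pos
    rw [nuInv, div_mul_div_comm, le_div_iff₀ (by positivity)]
    nlinarith [norm_nonneg (t.B k j)]
  · rw [hrun.outer_step k j hj]; exact hj.1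

end Trace

end ExactPenalty

/-! ### Assembly of the bounded and unbounded cases -/

theorem mainTheorem2 {n m : ℕ}
    (f : ExactPenalty.E n → ℝ) (c : ExactPenalty.E n → ExactPenalty.E m)
    (hf : ContDiff ℝ 1 f) (hc : ContDiff ℝ 1 c)
    (flow : ℝ) (hflow : ∀ x, flow ≤ f x)
    (p : ExactPenalty.Params) (x₀ : ExactPenalty.E n)
    (κB κm₁ κm₂ : ℝ) (hκm₁ : 0 < κm₁) (hκm₂ : 0 < κm₂) :
    -- bounded case: termination and explicit bounds
    (∀ t : ExactPenalty.Trace n, t.IsRun f c p x₀ →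
      t.BoundedHessians κB → t.ModelAccuracy f c p κm₁ κm₂ →
      ∀ ε δ τbar : ℝ, 0 < ε → ε ≤ p.ε₀ → ε ≤ δ → 0 ≤ τbar →
      (∀ k, τbar ≤ t.τ k → √(ExactPenalty.theta c (t.x (k + 1))) < ε) →
      ∃ K : ℕ, t.TerminatesAt f c p ε δ K ∧
        t.ExplicitBounds f c p flow κB κm₁ κm₂ τbar ε K) ∧
    -- bounded case: overall complexity
    (∀ Λ τlow : ℝ, 1 ≤ Λ → 0 < τlow → ∃ C : ℝ, 0 < C ∧
      ∀ t : ExactPenalty.Trace n, t.IsRun f c p x₀ →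
      t.BoundedHessians κB → t.ModelAccuracy f c p κm₁ κm₂ → t.GrowthLE Λ →
      ∀ ε δ τbar : ℝ, 0 < ε → ε ≤ p.ε₀ → ε ≤ δ → τlow ≤ τbar →
      (∀ k, τbar ≤ t.τ k → √(ExactPenalty.theta c (t.x (k + 1))) < ε) →
      ∃ K : ℕ, t.IsStopIndex c ε δ K ∧
        (t.totalInner f c p K : ℝ) ≤
          C * ((τbar + |Real.log (ε / p.ε₀)|) * τbar ^ 2 * (ε ^ 2)⁻¹)) ∧
    -- unbounded case: termination for every tolerance
    (∀ t : ExactPenalty.Trace n, t.IsRun f c p x₀ →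
      t.BoundedHessians κB → t.ModelAccuracy f c p κm₁ κm₂ →
      Filter.Tendsto t.τ Filter.atTop Filter.atTop →
      ∀ κg : ℝ, 0 ≤ κg → (∀ k, ‖gradient f (t.x k)‖ ≤ κg) →
      ∀ ε δ : ℝ, 0 < ε → ε ≤ p.ε₀ → ε ≤ δ →
      ∃ K : ℕ, t.TerminatesAt f c p ε δ K) ∧
    -- unbounded case: explicit bounds, with `(κg + 1) ε⁻² + 1` in place of `τbar`
    (∀ κg : ℝ, 0 ≤ κg → ∃ ε₁ : ℝ, 0 < ε₁ ∧
      ∀ t : ExactPenalty.Trace n, t.IsRun f c p x₀ →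
      t.BoundedHessians κB → t.ModelAccuracy f c p κm₁ κm₂ →
      Filter.Tendsto t.τ Filter.atTop Filter.atTop →
      (∀ k, ‖gradient f (t.x k)‖ ≤ κg) →
      ∀ ε δ : ℝ, 0 < ε → ε ≤ p.ε₀ → ε ≤ ε₁ → ε ≤ δ →
      ∃ K : ℕ, t.TerminatesAt f c p ε δ K ∧
        t.ExplicitBounds f c p flow κB κm₁ κm₂ ((κg + 1) * (ε ^ 2)⁻¹ + 1) ε K) ∧
    -- unbounded case: overall complexity
    (∀ Λ κg : ℝ, 1 ≤ Λ → 0 ≤ κg → ∃ C ε₁ : ℝ, 0 < C ∧ 0 < ε₁ ∧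
      ∀ t : ExactPenalty.Trace n, t.IsRun f c p x₀ →
      t.BoundedHessians κB → t.ModelAccuracy f c p κm₁ κm₂ → t.GrowthLE Λ →
      Filter.Tendsto t.τ Filter.atTop Filter.atTop →
      (∀ k, ‖gradient f (t.x k)‖ ≤ κg) →
      ∀ ε δ : ℝ, 0 < ε → ε ≤ p.ε₀ → ε ≤ ε₁ → ε ≤ δ →
      ∃ K : ℕ, t.IsStopIndex c ε δ K ∧
        (t.totalInner f c p K : ℝ) ≤ C * (ε ^ 8)⁻¹) := by
  have hD : 0 < p.θ / p.β₄ := div_pos p.θ_pos p.β₄_pos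
  have hε₁ : 0 < 1 / (4 + 4 * (p.θ / p.β₄)) := by positivity
  have hε₁1 : 1 / (4 + 4 * (p.θ / p.β₄)) ≤ 1 := by
    rw [div_le_one (by positivity)]; linarith
  refine ⟨?_, ?_, ?_, ?_, ?_⟩
  · intro t hrun hB hacc ε δ τbar hε hεε hδ _ hH
    -- The counting needs the hypothesis only at outer iterations that increase `τ`; this weaker
    -- form also covers the unbounded case.
    have hH' := fun k hk (_ : t.ε k < √(ExactPenalty.theta c (t.x (k + 1)))) => (hH k hk).le
    obtain ⟨K, hK, hKN⟩ := hrun.exists_isStopIndex hε hδ hH'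
    exact ⟨K, hrun.terminatesAt hflow hB hacc hε hK,
      hrun.explicitBounds hflow hB hacc hε hεε hδ hH' hK hKN⟩
  · intro Λ τlow hΛ hτlow
    obtain ⟨C, hC, h⟩ := ExactPenalty.Trace.exists_complexity_constant f c hflow p x₀ κB κm₁ κm₂
      hΛ hτlow
    exact ⟨C, hC, fun t hrun hB hacc hg ε δ τbar hε hεε hδ hτ hH =>
      h t hrun hB hacc hg ε δ τbar hε hεε hδ hτ fun k hk _ => (hH k hk).le⟩
  · intro t hrun hB hacc _ κg _ hκg ε δ hε _ hδ
    -- For `ε` above the threshold, the estimate is applied at `min ε ε₁` and then relaxed to `ε`.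
    obtain ⟨K, hK, -⟩ := hrun.exists_isStopIndex hε hδ fun k hk hlt =>
      (hrun.sqrt_theta_le_of_gradient_le hflow hB hacc hκg (lt_min hε hε₁) (min_le_right _ _)
        k hk hlt).trans (min_le_left _ _)
    exact ⟨K, hrun.terminatesAt hflow hB hacc hε hK⟩
  · intro κg _
    refine ⟨_, hε₁, fun t hrun hB hacc _ hκg ε δ hε hεε hεε₁ hδ => ?_⟩
    have hH := hrun.sqrt_theta_le_of_gradient_le hflow hB hacc hκg hε hεε₁
    obtain ⟨K, hK, hKN⟩ := hrun.exists_isStopIndex hε hδ hH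
    exact ⟨K, hrun.terminatesAt hflow hB hacc hε hK,
      hrun.explicitBounds hflow hB hacc hε hεε hδ hH hK hKN⟩
  · intro Λ κg hΛ hκg0
    obtain ⟨C, hC, h⟩ := ExactPenalty.Trace.exists_complexity_constant f c hflow p x₀ κB κm₁ κm₂
      hΛ one_pos
    have hε₀ := p.ε₀_pos
    -- With `τbar ≤ (κg + 2) ε⁻²` and `|log (ε / ε₀)| ≤ ε₀ ε⁻²`, the factors `τbar + |log|`, `τbar²`
    -- and `ε⁻²` contribute `ε⁻²`, `ε⁻⁴` and `ε⁻²`.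
    refine ⟨C * ((κg + 2 + p.ε₀) * (κg + 2) ^ 2), _, by positivity, hε₁,
      fun t hrun hB hacc hg _ hκg ε δ hε hεε hεε₁ hδ => ?_⟩
    have hτ1 : 1 ≤ (κg + 1) * (ε ^ 2)⁻¹ + 1 := by
      have : 0 ≤ (κg + 1) * (ε ^ 2)⁻¹ := by positivity
      linarith
    obtain ⟨K, hK, hle⟩ := h t hrun hB hacc hg ε δ _ hε hεε hδ hτ1
      (hrun.sqrt_theta_le_of_gradient_le hflow hB hacc hκg hε hεε₁)
    refine ⟨K, hK, hle.trans ?_⟩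
    have hε1 : ε ≤ 1 := hεε₁.trans hε₁1
    have hinv : 1 ≤ (ε ^ 2)⁻¹ := (one_le_inv₀ (by positivity)).2 (pow_le_one₀ hε.le hε1)
    have hτbar : (κg + 1) * (ε ^ 2)⁻¹ + 1 ≤ (κg + 2) * (ε ^ 2)⁻¹ := by linarith
    have hlog : |Real.log (ε / p.ε₀)| ≤ p.ε₀ * (ε ^ 2)⁻¹ := by
      rw [abs_of_nonpos (Real.log_nonpos (by positivity) ((div_le_one hε₀).2 hεε)),
        ← Real.log_inv, inv_div]
      refine (Real.log_le_self (by positivity)).trans ?_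
      rw [div_eq_mul_inv]
      refine mul_le_mul_of_nonneg_left ((inv_le_inv₀ hε (by positivity)).2 ?_) hε₀.le
      nlinarith
    have e : C * ((κg + 2 + p.ε₀) * (κg + 2) ^ 2) * (ε ^ 8)⁻¹
        = C * (((κg + 2) * (ε ^ 2)⁻¹ + p.ε₀ * (ε ^ 2)⁻¹) * ((κg + 2) * (ε ^ 2)⁻¹) ^ 2
          * (ε ^ 2)⁻¹) := by
      field_simp
    rw [e]
    gcongr
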